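/- There exist a connected, locally finite graph $G$ with exactly one end and an assignment $\ell\colon E(G)\to\mathbb R_{>0}$ of edge lengths such that $(|G|,\ell)$ is a metric representation of $G$ and every $\ell$-geodetic circle in $|G|$ contains infinitely many edges (no $\ell$-geodetic circle is finite). In particular, for this $G$ and $\ell$, the finite $\ell$-geodetic circles do not generate the topological cycle space $\mathcal C(G)$, whereas the finite circles of $G$ do. Here $|G|$ is the 1-complex $G$ together with the ends of $G$, with the topology in which a set is open if it meets $G$ in an open set of the 1-complex and, for each of its ends $\omega$, contains, for some finite vertex set $S$, the component $C(S,\omega)$ of $G-S$ in which $\omega$ lives together with all ends that live in $C(S,\omega)$ (the Freudenthal compactification). A circle in $|G|$ is a homeomorphic image of $S^1$; it is finite if it contains only finitely many edges. An arc is a homeomorphic image of $[0,1]$ or a single point. The length of an arc is the sum over all edges $e$ of the length of its part in $e$, where $e$ is an interval of length $\ell(e)$, and $d_\ell(x,y)$ is the infimum of the lengths of all $x$–$y$ arcs in $|G|$. The pair $(|G|,\ell)$ is a metric representation of $G$ if $d_\ell$ is a metric on $|G|$ inducing the topology of $|G|$. A circle $C$ is $\ell$-geodetic if for any two points $x,y\in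 C$ one of the $x$–$y$ arcs in $C$ has length $d_\ell(x,y)$. A circuit is the set of edges contained in a circle; a family of edge sets is thin if no edge lies in infinitely many members, and its sum is the set of edges that lie in an odd number of members. $\mathcal C(G)$ is the set of all sums of thin families of circuits, and a set of circles generates $\mathcal C(G)$ if $\mathcal C(G)$ is the set of all sums of thin families of their circuits. -/

import Mathlib

open scoped ENNReal

namespace SimpleGraph

universe u

variable {V : Type u} (G : SimpleGraph V)

/-- The component `C(S, ω)` of `G - S` in which the end `ω` lives. -/
def endComponent (S : Finset V) (ω : G.end) : G.ComponentCompl (S : Set V) :=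
  ω.1 (Opposite.op S)

theorem endComponent_hom {S T : Finset V} (h : (S : Set V) ⊆ T) (ω : G.end) :
    (G.endComponent T ω).hom h = G.endComponent S ω :=
  ω.2 (CategoryTheory.opHomOfLE (Finset.coe_subset.mp h))

/-- The points of `|G|`: the vertices, the inner points of the edges and the ends of `G`.
Every edge `e` is a copy of the interval `[0, 1]`, running from its endvertex `e.out.1` to its
endvertex `e.out.2` (an arbitrary choice of orientation). -/
inductive EndSpace : Type u
  | vert (v : V) : EndSpace
  | inner (e : G.edgeSet) (t : Set.Ioo (0 : ℝ) 1) : EndSpace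
  | atEnd (ω : G.end) : EndSpace

namespace EndSpace

variable {G}

open Classical in
/-- The parametrisation of the closed edge `e` by the unit interval. -/
noncomputable def edgePath (e : G.edgeSet) (t : unitInterval) : G.EndSpace :=
  if h0 : t = 0 then vert (Quot.out e.1).1
  else if h1 : t = 1 then vert (Quot.out e.1).2
  else inner e ⟨t, unitInterval.pos_iff_ne_zero.mpr h0, unitInterval.lt_one_iff_ne_one.mpr h1⟩

/-- `U` contains the component `C(S, ω)`, that is, its vertices and its edges, as well as all the
ends `ω'` that live in `C(S, ω)`. -/
def ContainsComponent (U : Set G.EndSpace) (S : Finset V) (ω : G.end) : Prop :=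
  (∀ v ∈ G.endComponent S ω, vert v ∈ U) ∧
  (∀ (e : G.edgeSet) (t : Set.Ioo (0 : ℝ) 1),
    (∀ v ∈ e.1, v ∈ G.endComponent S ω) → inner e t ∈ U) ∧
  (∀ ω' : G.end, G.endComponent S ω' = G.endComponent S ω → atEnd ω' ∈ U)

theorem ContainsComponent.mono {U U' : Set G.EndSpace} {S S' : Finset V} {ω : G.end}
    (h : ContainsComponent U S ω) (hU : U ⊆ U') (hS : S ⊆ S') : ContainsComponent U' S' ω := by
  have hS' : (S : Set V) ⊆ S' := Finset.coe_subset.mpr hS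
  have hC : ∀ v, v ∈ G.endComponent S' ω → v ∈ G.endComponent S ω := by
    intro v hv
    rw [← G.endComponent_hom hS' ω]
    exact ComponentCompl.subset_hom _ hS' hv
  refine ⟨fun v hv => hU (h.1 v (hC v hv)),
    fun e t he => hU (h.2.1 e t fun v hv => hC v (he v hv)), fun ω' h' => hU (h.2.2 ω' ?_)⟩
  rw [← G.endComponent_hom hS' ω, ← G.endComponent_hom hS' ω', h']

/-- The topology of `|G|`. A set is open if its trace on the `1`-complex `G` is open, i.e. if it
meets every closed edge in a relatively open set, and if with every end `ω` it contains
`C(S, ω) ∪ Ω(S, ω)` for some finite set `S` of vertices. (By the first condition, it then also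
contains a half-edge `(z, y]` of every edge `xy` with `x ∈ S` and `y ∈ C(S, ω)`.) -/
instance instTopologicalSpace : TopologicalSpace G.EndSpace where
  IsOpen U := (∀ e : G.edgeSet, IsOpen (edgePath e ⁻¹' U)) ∧
    ∀ ω : G.end, atEnd ω ∈ U → ∃ S : Finset V, ContainsComponent U S ω
  isOpen_univ := ⟨fun _ => isOpen_univ, fun _ _ => ⟨∅, by simp [ContainsComponent]⟩⟩
  isOpen_inter U U' h h' := by
    classical
    refine ⟨fun e => (h.1 e).inter (h'.1 e), fun ω hω => ?_⟩
    obtain ⟨S, hS⟩ := h.2 ω hω.1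
    obtain ⟨S', hS'⟩ := h'.2 ω hω.2
    have k := hS.mono subset_rfl (Finset.subset_union_left (s₂ := S'))
    have k' := hS'.mono subset_rfl (Finset.subset_union_right (s₁ := S))
    exact ⟨S ∪ S', fun v hv => ⟨k.1 v hv, k'.1 v hv⟩,
      fun e t he => ⟨k.2.1 e t he, k'.2.1 e t he⟩, fun ω' hω' => ⟨k.2.2 ω' hω', k'.2.2 ω' hω'⟩⟩
  isOpen_sUnion 𝒰 h := by
    refine ⟨fun e => ?_, fun ω hω => ?_⟩
    · rw [Set.preimage_sUnion]
      exact isOpen_biUnion fun U hU => (h U hU).1 e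
    · obtain ⟨U, hU, hω⟩ := hω
      obtain ⟨S, hS⟩ := (h U hU).2 ω hω
      exact ⟨S, hS.mono (Set.subset_sUnion_of_mem hU) subset_rfl⟩

/-- `A` is an `x`-`y` arc in `|G|`: a homeomorphic image of the unit interval with endpoints `x`
and `y`, or a single point. -/
def IsArc (x y : G.EndSpace) (A : Set G.EndSpace) : Prop :=
  (x = y ∧ A = {x}) ∨
  ∃ f : unitInterval → G.EndSpace,
    Topology.IsEmbedding f ∧ f 0 = x ∧ f 1 = y ∧ Set.range f = A

/-- A circle in `|G|`: a homeomorphic image of the unit circle. -/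
def IsCircle (C : Set G.EndSpace) : Prop :=
  ∃ f : Circle → G.EndSpace, Topology.IsEmbedding f ∧ Set.range f = C

/-- The set of edges of `G` contained in `X`. -/
def edgesIn (X : Set G.EndSpace) : Set G.edgeSet :=
  {e | ∀ t, edgePath e t ∈ X}

/-- The length of `X`, where each edge `e` is an interval of length `ℓ e`: the sum over all edges
`e` of the length of `e ∩ X`. -/
noncomputable def length (ℓ : G.edgeSet → ℝ) (X : Set G.EndSpace) : ℝ≥0∞ :=
  ∑' e : G.edgeSet, ENNReal.ofReal (ℓ e) *
    MeasureTheory.volume {t : ℝ | ∃ ht : t ∈ Set.Ioo (0 : ℝ) 1, inner e ⟨t, ht⟩ ∈ X}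

/-- `d_ℓ(x, y)`: the infimum of the lengths of all `x`-`y` arcs. -/
noncomputable def arcDist (ℓ : G.edgeSet → ℝ) (x y : G.EndSpace) : ℝ≥0∞ :=
  ⨅ (A : Set G.EndSpace) (_ : IsArc x y A), length ℓ A

/-- A circle `C` is `ℓ`-geodetic if for all points `x, y` of `C` one of the `x`-`y` arcs in `C` has
length `d_ℓ(x, y)`. -/
def IsGeodeticCircle (ℓ : G.edgeSet → ℝ) (C : Set G.EndSpace) : Prop :=
  IsCircle C ∧ ∀ x ∈ C, ∀ y ∈ C, ∃ A ⊆ C, IsArc x y A ∧ length ℓ A = arcDist ℓ x y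

end EndSpace

/-- `(|G|, ℓ)` is a metric representation of `G`: the edge lengths are positive and `d_ℓ` is a
(finite-valued) metric that induces the topology of `|G|`. -/
def IsMetricRepresentation (ℓ : G.edgeSet → ℝ) : Prop :=
  (∀ e, 0 < ℓ e) ∧
  ∃ m : MetricSpace G.EndSpace,
    (∀ x y, EndSpace.arcDist ℓ x y = ENNReal.ofReal (m.dist x y)) ∧
    m.toUniformSpace.toTopologicalSpace = EndSpace.instTopologicalSpace

/-- The circuits of `G`: the edge sets of the circles in `|G|`. -/
def circuits : Set (Set G.edgeSet) :=
  {D | ∃ C : Set G.EndSpace, EndSpace.IsCircle C ∧ D = EndSpace.edgesIn C}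

/-- The `ℓ`-geodetic circuits of `G`: the edge sets of the `ℓ`-geodetic circles in `|G|`. -/
def geodeticCircuits (ℓ : G.edgeSet → ℝ) : Set (Set G.edgeSet) :=
  {D | ∃ C : Set G.EndSpace, EndSpace.IsGeodeticCircle ℓ C ∧ D = EndSpace.edgesIn C}

/-- The set of all sums of thin families of members of `N`. A family is thin if every edge lies in
only finitely many members; its sum consists of the edges that lie in an odd number of members. -/
def thinSums {E : Type u} (N : Set (Set E)) : Set (Set E) :=
  {D | ∃ (ι : Type u) (F : ι → Set E), (∀ i, F i ∈ N) ∧ (∀ e, {i | e ∈ F i}.Finite) ∧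
    D = {e | Odd {i | e ∈ F i}.ncard}}

/-- The topological cycle space `𝒞(G)`. -/
def topCycleSpace : Set (Set G.edgeSet) :=
  thinSums G.circuits

/-- `N` generates `𝒞(G)`: the elements of `𝒞(G)` are precisely the sums of thin families of
members of `N`. -/
def GeneratesTopCycleSpace (N : Set (Set G.edgeSet)) : Prop :=
  thinSums N = G.topCycleSpace

/-- `G` has exactly one end. -/
def IsOneEnded : Prop :=
  G.end.ncard = 1

end SimpleGraph

/-! The graph is the one-way infinite ladder, with edge lengths for which its end is a shortcut. The
`k`-th edge of either side has length 4⁻ᵏ / 4, so a side has length `tailLen k` = 4⁻ᵏ / 3 from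
height `k` to the end. The `k`-th rung has length 4 * 4⁻ᵏ = 12 * `tailLen k`. The endvertices of the
`i`-th rung thus have distance at most 2 * `tailLen i`, measured through the end
(`arcDist_rung_le`).

A circle with finitely many edges contains some rung, because it has even degree at every vertex
(`IsEven.exists_rung_mem`). Let `N` bound the heights of its vertices. Assign to a vertex of height
`k` ≤ `N` the value `tailLen k` + `tailLen N` on one side and its negative on the other. Along the
edges of the circle this function changes by at most their length, so an arc in the circle between
the endvertices of its `i`-th rung has length at least 2 * `tailLen i` + 2 * `tailLen N`
(`lt_length_of_finite`). It is longer than the detour, so the circle is not geodetic. The comparison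
of lengths with variations holds for arcs through ends too, as vertices and ends are countable and
so have null image in the reals (`IsArc.ofReal_abs_sub_le`).

For the metric representation, the space is compact and d_ℓ is a metric whose topology is coarser;
compact against Hausdorff gives equality (`isMetricRepresentation_of_compactSpace`).

Finite circles generate because circles have even degree at every vertex
(`IsCircle.even_ncard_edgesIn`), thin sums preserve this (`even_ncard_inter_of_mem_thinSums`), and
an even edge set of the ladder is a thin sum of squares (`IsEven.mem_thinSums`). -/

section

open Set Topology Filter

/-! ### Arcs and circles in Hausdorff spaces -/

section TopologicalArcs

theorem infinite_of_injOn_Ico {X : Type*} {g : ℝ → X} (hg : InjOn g (Ico 0 1)) :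
    (g '' Ico 0 1).Infinite :=
  (Ico_infinite one_pos).image hg

theorem image_Ioo_eq_diff {X : Type*} {g : ℝ → X} (hi : InjOn g (Ico 0 1)) :
    g '' Ioo 0 1 = g '' Ico 0 1 \ {g 0} := by
  rw [← Ioo_insert_left zero_lt_one, image_insert_eq]
  ext x
  constructor
  · rintro ⟨t, ht, rfl⟩
    refine ⟨Or.inr ⟨t, ht, rfl⟩, fun h => ?_⟩
    exact ht.1.ne' (hi ⟨ht.1.le, ht.2⟩ ⟨le_rfl, one_pos⟩ h)
  · rintro ⟨rfl | h, h'⟩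
    · exact (h' rfl).elim
    · exact h

variable {X : Type*} [TopologicalSpace X]

theorem exists_isEmbedding_unitInterval_of_Icc [T2Space X] {f : ℝ → X} {a b : ℝ} (hab : a < b)
    (hf : ContinuousOn f (Icc a b)) (hi : InjOn f (Icc a b)) :
    ∃ g : unitInterval → X, IsEmbedding g ∧ g 0 = f a ∧ g 1 = f b ∧ range g = f '' Icc a b := by
  have hc : Continuous ((Icc a b).domRestrict f) := hf.domRestrict
  have hi' : Function.Injective ((Icc a b).domRestrict f) := injOn_iff_injective.mp hi
  refine ⟨(Icc a b).domRestrict f ∘ (iccHomeoI a b hab).symm, ?_, ?_, ?_, ?_⟩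
  · exact (hc.isClosedEmbedding hi').isEmbedding.comp (iccHomeoI a b hab).symm.isEmbedding
  · exact congrArg f (by simp)
  · exact congrArg f (by simp)
  · rw [(iccHomeoI a b hab).symm.surjective.range_comp, range_domRestrict]

/-- Two arcs, the first ending where the second begins, contain an arc between the two
other endpoints. -/
theorem exists_arc_trans [T2Space X] {f g : ℝ → X} {a b c d : ℝ} (hab : a ≤ b) (hcd : c ≤ d)
    (hf : ContinuousOn f (Icc a b)) (hfi : InjOn f (Icc a b))
    (hg : ContinuousOn g (Icc c d)) (hgi : InjOn g (Icc c d)) (hfg : f b = g c) :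
    ∃ (h : ℝ → X) (e : ℝ), a ≤ e ∧ ContinuousOn h (Icc a e) ∧ InjOn h (Icc a e) ∧
      h a = f a ∧ h e = g d ∧ h '' Icc a e ⊆ f '' Icc a b ∪ g '' Icc c d ∧
      (f '' Icc a b ∩ g '' Icc c d ⊆ {f b} →
        h '' Icc a e = f '' Icc a b ∪ g '' Icc c d) := by
  have hB : IsClosed (g '' Icc c d) := (isCompact_Icc.image_of_continuousOn hg).isClosed
  have hT : IsCompact (Icc a b ∩ f ⁻¹' (g '' Icc c d)) :=
    isCompact_Icc.of_isClosed_subset (hf.preimage_isClosed_of_isClosed isClosed_Icc hB)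
      inter_subset_left
  -- `s` is the first parameter at which `f` meets the second arc. Following `f` up to `s` and then
  -- `g` from `r` on never repeats a point.
  obtain ⟨s, ⟨hs, r, hr, hrs⟩, hmin⟩ := hT.exists_isLeast
    ⟨b, right_mem_Icc.mpr hab, c, left_mem_Icc.mpr hcd, hfg.symm⟩
  have hlt : ∀ t ∈ Icc a s, ∀ u ∈ Icc c d, f t = g u → t = s := fun t ht u hu htu =>
    le_antisymm ht.2 (hmin ⟨⟨ht.1, ht.2.trans hs.2⟩, u, hu, htu.symm⟩)
  have hl : ∀ t ∈ Icc a s, t ∈ Icc a b := fun t ht => ⟨ht.1, ht.2.trans hs.2⟩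
  have hrt : ∀ t ∈ Icc s (s + (d - r)), t - s + r ∈ Icc c d := fun t ht =>
    ⟨by linarith [ht.1, hr.1], by linarith [ht.2]⟩
  have hd : s ≤ s + (d - r) := by linarith [hr.2]
  set h : ℝ → X := fun t => if t ≤ s then f t else g (t - s + r) with hh
  have h1 : EqOn h f (Icc a s) := fun t ht => if_pos ht.2
  have h2 : EqOn h (fun t => g (t - s + r)) (Icc s (s + (d - r))) := by
    intro t ht
    rcases ht.1.eq_or_lt with rfl | h'
    · simp [hh, hrs]
    · simp [hh, not_le.mpr h']
  have hU : Icc a (s + (d - r)) = Icc a s ∪ Icc s (s + (d - r)) :=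
    (Icc_union_Icc_eq_Icc hs.1 hd).symm
  refine ⟨h, s + (d - r), hs.1.trans hd, ?_, ?_, ?_, ?_, ?_, fun hAB => ?_⟩
  · rw [hU]
    refine ContinuousOn.union_of_isClosed ?_ ?_ isClosed_Icc isClosed_Icc
    · exact (hf.mono hl).congr h1
    · exact (hg.comp (by fun_prop) hrt).congr h2
  · have key : ∀ t ∈ Icc a s, ∀ u ∈ Icc s (s + (d - r)), h t = h u → t = u := by
      intro t ht u hu htu
      rw [h1 ht, h2 hu] at htu
      have := hlt t ht _ (hrt u hu) htu
      subst this
      have := hgi hr (hrt u hu) (hrs.trans htu)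
      linarith
    rw [hU]
    rintro t (ht | ht) u (hu | hu) htu
    · exact hfi (hl t ht) (hl u hu) (by rw [← h1 ht, ← h1 hu, htu])
    · exact key t ht u hu htu
    · exact (key u hu t ht htu.symm).symm
    · have := hgi (hrt t ht) (hrt u hu) (by simpa only [h2 ht, h2 hu] using htu)
      linarith
  · exact h1 (left_mem_Icc.mpr hs.1)
  · rw [h2 (right_mem_Icc.mpr hd)]
    exact congrArg g (by ring)
  · rw [hU, image_union]
    refine union_subset_union ?_ ?_
    · rintro _ ⟨t, ht, rfl⟩
      exact ⟨t, hl t ht, (h1 ht).symm⟩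
    · rintro _ ⟨t, ht, rfl⟩
      exact ⟨_, hrt t ht, (h2 ht).symm⟩
  -- If the arcs meet only in their common endpoint, then `s = b` and `r = c`, so nothing is cut
  -- off.
  · have hfs : f s = f b := hAB ⟨⟨s, hs, rfl⟩, ⟨r, hr, hrs⟩⟩
    obtain rfl : s = b := hfi hs (right_mem_Icc.mpr hab) hfs
    obtain rfl : r = c := hgi hr (left_mem_Icc.mpr hcd) (hrs.trans hfg)
    have h3 : (fun t => g (t - s + r)) '' Icc s (s + (d - r)) = g '' Icc r d := by
      ext z
      constructor
      · rintro ⟨t, ht, rfl⟩; exact ⟨_, hrt t ht, rfl⟩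
      · rintro ⟨t, ht, rfl⟩
        exact ⟨t - r + s, ⟨by linarith [ht.1], by linarith [ht.2]⟩, congrArg g (by ring)⟩
    rw [hU, image_union, h1.image_eq, h2.image_eq, h3]

theorem exists_isEmbedding_circle_of_Icc [T2Space X] {f : ℝ → X} {a b : ℝ} (hab : a < b)
    (hf : ContinuousOn f (Icc a b)) (hi : InjOn f (Ico a b)) (h : f a = f b) :
    ∃ g : Circle → X, IsEmbedding g ∧ range g = f '' Ico a b := by
  have : Fact (0 < b - a) := ⟨sub_pos.mpr hab⟩
  have hb : a + (b - a) = b := by ring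
  have hc : Continuous (AddCircle.liftIco (b - a) a f) :=
    AddCircle.liftIco_continuous (by rw [hb, h]) (by rwa [hb])
  have hj : Function.Injective (AddCircle.liftIco (b - a) a f) := by
    intro x y hxy
    obtain ⟨x, hx, rfl⟩ := (AddCircle.coe_image_Ico_eq (b - a) a).symm ▸ mem_univ x
    obtain ⟨y, hy, rfl⟩ := (AddCircle.coe_image_Ico_eq (b - a) a).symm ▸ mem_univ y
    rw [AddCircle.liftIco_coe_apply hx, AddCircle.liftIco_coe_apply hy] at hxy
    rw [hb] at hx hy
    rw [hi hx hy hxy]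
  let H := (AddCircle.homeomorphCircle (sub_pos.mpr hab).ne').symm
  refine ⟨AddCircle.liftIco (b - a) a f ∘ H,
    (hc.isClosedEmbedding hj).isEmbedding.comp H.isEmbedding, ?_⟩
  rw [H.surjective.range_comp, ← image_univ, ← AddCircle.coe_image_Ico_eq (b - a) a, hb,
    image_image]
  refine image_congr fun x hx => ?_
  rw [← hb] at hx
  exact AddCircle.liftIco_coe_apply hx

theorem exists_param_of_isEmbedding_circle {f : Circle → X} (hf : IsEmbedding f) {v : X}
    (hv : v ∈ range f) :
    ∃ g : ℝ → X, Continuous g ∧ InjOn g (Ico 0 1) ∧ g 0 = v ∧ g 1 = v ∧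
      g '' Ico 0 1 = range f := by
  obtain ⟨z, rfl⟩ := hv
  let H := AddCircle.homeomorphCircle (one_ne_zero (α := ℝ))
  have hq : Continuous fun t : ℝ => (t : AddCircle (1 : ℝ)) := AddCircle.continuous_mk' 1
  refine ⟨fun t => f (H (H.symm z + (t : AddCircle (1 : ℝ)))), ?_, ?_, ?_, ?_, ?_⟩
  · exact hf.continuous.comp (H.continuous.comp (continuous_const.add hq))
  · intro x hx y hy hxy
    have hxy' := add_left_cancel (H.injective (hf.injective hxy))
    have : Fact (0 < (1 : ℝ)) := ⟨one_pos⟩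
    exact (AddCircle.coe_eq_coe_iff_of_mem_Ico (a := (0 : ℝ)) (p := (1 : ℝ))
      (by simpa using hx) (by simpa using hy)).mp hxy'
  · simp
  · simp only [AddCircle.coe_period]
    simp
  · have : Fact (0 < (1 : ℝ)) := ⟨one_pos⟩
    have h1 : (fun t : ℝ => (t : AddCircle (1 : ℝ))) '' Ico 0 1 = univ := by
      simpa using AddCircle.coe_image_Ico_eq (1 : ℝ) 0
    apply subset_antisymm
    · rintro _ ⟨t, -, rfl⟩
      exact mem_range_self _
    · rintro _ ⟨w, rfl⟩
      obtain ⟨t, ht, hw⟩ := h1.symm ▸ mem_univ (H.symm w - H.symm z)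
      refine ⟨t, ht, ?_⟩
      simp only at hw
      simp [hw]

/-- The image of `Ioo 0 1` under `γ` is an open arc of `X`. -/
structure IsOpenArc (γ : ℝ → X) : Prop where
  continuousOn : ContinuousOn γ (Ioo 0 1)
  injOn : InjOn γ (Ioo 0 1)
  isOpen_image : ∀ U ⊆ Ioo (0 : ℝ) 1, IsOpen U → IsOpen (γ '' U)

theorem IsOpenArc.symm {γ : ℝ → X} (h : IsOpenArc γ) : IsOpenArc fun t => γ (1 - t) := by
  have hm : MapsTo (fun t : ℝ => 1 - t) (Ioo 0 1) (Ioo 0 1) := fun t ht =>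
    ⟨by linarith [ht.2], by linarith [ht.1]⟩
  refine ⟨h.continuousOn.comp (by fun_prop) hm, fun s hs t ht hst => ?_, fun U hU hU' => ?_⟩
  · linarith [h.injOn (hm hs) (hm ht) hst]
  · have := h.isOpen_image ((fun t : ℝ => 1 - t) '' U) (by
      rintro _ ⟨t, ht, rfl⟩; exact hm (hU ht)) ((Homeomorph.subLeft (1 : ℝ)).isOpenMap U hU')
    rwa [image_image] at this

/-- `C` is a topological circle, parametrised from each of its points. -/
structure IsTopCircle (C : Set X) : Prop where
  nonempty : C.Nonempty
  exists_param : ∀ v ∈ C, ∃ g : ℝ → X, Continuous g ∧ InjOn g (Ico 0 1) ∧ g 0 = v ∧ g 1 = v ∧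
      g '' Ico 0 1 = C

theorem isTopCircle_range {f : Circle → X} (hf : IsEmbedding f) : IsTopCircle (range f) :=
  ⟨range_nonempty f, fun _ hv => exists_param_of_isEmbedding_circle hf hv⟩

theorem IsTopCircle.infinite {C : Set X} (hC : IsTopCircle C) : C.Infinite := by
  obtain ⟨v, hv⟩ := hC.nonempty
  obtain ⟨g, -, hi, -, -, rfl⟩ := hC.exists_param v hv
  exact infinite_of_injOn_Ico hi

theorem IsTopCircle.not_countable {C : Set X} (hC : IsTopCircle C) : ¬ C.Countable := by
  obtain ⟨v, hv⟩ := hC.nonempty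
  obtain ⟨g, -, hi, -, -, rfl⟩ := hC.exists_param v hv
  intro h
  have h1 : (Ico (0 : ℝ) 1).Countable := (mapsTo_image g _).countable_of_injOn hi h
  have h2 := h1.measure_zero MeasureTheory.volume
  simp at h2

theorem IsTopCircle.isClosed [T2Space X] {C : Set X} (hC : IsTopCircle C) : IsClosed C := by
  obtain ⟨v, hv⟩ := hC.nonempty
  obtain ⟨g, hg, hi, h0, h1, rfl⟩ := hC.exists_param v hv
  have : g '' Ico 0 1 = g '' Icc 0 1 := by
    rw [← Ico_insert_right zero_le_one, image_insert_eq, h1, insert_eq_of_mem hv]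
  rw [this]
  exact (isCompact_Icc.image hg).isClosed

theorem IsTopCircle.isPreconnected {C : Set X} (hC : IsTopCircle C) : IsPreconnected C := by
  obtain ⟨v, hv⟩ := hC.nonempty
  obtain ⟨g, hg, hi, h0, h1, rfl⟩ := hC.exists_param v hv
  exact isPreconnected_Ico.image g hg.continuousOn

theorem IsTopCircle.isPreconnected_diff {C : Set X} (hC : IsTopCircle C) {v : X} (hv : v ∈ C) :
    IsPreconnected (C \ {v}) := by
  obtain ⟨g, hg, hi, rfl, h1, rfl⟩ := hC.exists_param v hv
  rw [← image_Ioo_eq_diff hi]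
  exact isPreconnected_Ioo.image g hg.continuousOn

theorem IsOpenArc.isClosed_image_Icc [T2Space X] {γ : ℝ → X} (h : IsOpenArc γ) {s r : ℝ}
    (hs : 0 < s) (hr : r < 1) : IsClosed (γ '' Icc s r) :=
  (isCompact_Icc.image_of_continuousOn (h.continuousOn.mono fun _ ht =>
    ⟨hs.trans_le ht.1, ht.2.trans_lt hr⟩)).isClosed

/-- A circle stays connected when the point `γ s` is deleted. The rest of `C` avoids both boundary
points of the segment, so it lies wholly inside or wholly outside. -/
theorem IsTopCircle.subset_or_disjoint [T2Space X] {C : Set X} (hC : IsTopCircle C) {γ : ℝ → X}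
    (h : IsOpenArc γ) {s r : ℝ} (hs : 0 < s) (hsr : s < r) (hr : r < 1) (hsC : γ s ∈ C)
    (hrC : γ r ∉ C) : C \ {γ s} ⊆ γ '' Ioo s r ∨ Disjoint C (γ '' Ioo s r) := by
  have hsub : Ioo s r ⊆ Ioo 0 1 := Ioo_subset_Ioo hs.le hr.le
  have ho : IsOpen (γ '' Ioo s r) := h.isOpen_image _ hsub isOpen_Ioo
  have hc := (h.isClosed_image_Icc hs hr).isOpen_compl
  have hd : Disjoint (γ '' Ioo s r) (γ '' Icc s r)ᶜ :=
    disjoint_compl_right.mono_left (image_mono Ioo_subset_Icc_self)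
  have hcov : C \ {γ s} ⊆ γ '' Ioo s r ∪ (γ '' Icc s r)ᶜ := by
    rintro x ⟨hx, hxs⟩
    by_cases hx' : x ∈ γ '' Icc s r
    · obtain ⟨t, ht, rfl⟩ := hx'
      refine Or.inl ⟨t, ⟨ht.1.lt_of_ne ?_, ht.2.lt_of_ne ?_⟩, rfl⟩
      · rintro rfl; exact hxs rfl
      · rintro rfl; exact hrC hx
    · exact Or.inr hx'
  rcases (hC.isPreconnected_diff hsC).subset_or_subset ho hc hd hcov with h1 | h1
  · exact Or.inl h1
  · refine Or.inr (disjoint_left.mpr fun x hx hx' => ?_)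
    obtain ⟨t, ht, rfl⟩ := hx'
    have hne : γ t ≠ γ s := fun he =>
      ht.1.ne' (h.injOn (hsub ht) ⟨hs, hsr.trans hr⟩ he)
    exact h1 ⟨hx, hne⟩ ⟨t, Ioo_subset_Icc_self ht, rfl⟩

/-- In the other case of the dichotomy the segment contains two further points `γ t₁`, `γ t₂` of
`C`, say with `t₁ < t₂`. The dichotomy applied from `t₁` then excludes either `γ s` or `γ t₂` from
`C`. -/
theorem IsTopCircle.disjoint_image_Ioo [T2Space X] {C : Set X} (hC : IsTopCircle C) {γ : ℝ → X}
    (h : IsOpenArc γ) {s r : ℝ} (hs : 0 < s) (hsr : s < r) (hr : r < 1) (hsC : γ s ∈ C)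
    (hrC : γ r ∉ C) : Disjoint C (γ '' Ioo s r) := by
  refine (hC.subset_or_disjoint h hs hsr hr hsC hrC).resolve_left fun hsub => ?_
  have hinf : (C \ {γ s}).Infinite := hC.infinite.sdiff (finite_singleton _)
  obtain ⟨x, hx, y, hy, hxy⟩ := hinf.nontrivial
  obtain ⟨t₁, h₁, rfl⟩ := hsub hx
  obtain ⟨t₂, h₂, rfl⟩ := hsub hy
  have key : ∀ t₁ ∈ Ioo s r, ∀ t₂ ∈ Ioo s r, γ t₁ ∈ C → γ t₂ ∈ C → t₁ < t₂ → False := by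
    intro t₁ h₁ t₂ h₂ hx hy hlt
    rcases hC.subset_or_disjoint h (hs.trans h₁.1) h₁.2 hr hx hrC with h' | h'
    · have hne : γ s ≠ γ t₁ := fun he => h₁.1.ne (h.injOn ⟨hs, hsr.trans hr⟩
        ⟨hs.trans h₁.1, h₁.2.trans hr⟩ he)
      obtain ⟨u, hu, hus⟩ := h' ⟨hsC, hne⟩
      have := h.injOn ⟨hs.trans (h₁.1.trans hu.1), hu.2.trans hr⟩ ⟨hs, hsr.trans hr⟩ hus
      linarith [hu.1, h₁.1]
    · exact disjoint_left.mp h' hy ⟨t₂, ⟨hlt, h₂.2⟩, rfl⟩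
  rcases lt_trichotomy t₁ t₂ with hlt | rfl | hlt
  · exact key _ h₁ _ h₂ hx.1 hy.1 hlt
  · exact hxy rfl
  · exact key _ h₂ _ h₁ hy.1 hx.1 hlt

/-- Otherwise `γ s` is the only point of `C` on the open set `γ '' Ioo 0 r`, hence isolated in `C`,
which contradicts connectedness. -/
theorem IsTopCircle.mem_of_lt [T2Space X] {C : Set X} (hC : IsTopCircle C) {γ : ℝ → X}
    (h : IsOpenArc γ) {s r : ℝ} (hs : 0 < s) (hsr : s < r) (hr : r < 1) (hsC : γ s ∈ C) :
    γ r ∈ C := by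
  by_contra hrC
  have hD : ∀ t, 0 < t → t < r → γ t ∈ C → t = s := by
    intro t ht htr htC
    rcases lt_trichotomy t s with h' | h' | h'
    · exact (disjoint_left.mp (hC.disjoint_image_Ioo h ht htr hr htC hrC) hsC
        ⟨s, ⟨h', hsr⟩, rfl⟩).elim
    · exact h'
    · exact (disjoint_left.mp (hC.disjoint_image_Ioo h hs hsr hr hsC hrC) htC
        ⟨t, ⟨h', htr⟩, rfl⟩).elim
  have ho : IsOpen (γ '' Ioo 0 r) := h.isOpen_image _ (Ioo_subset_Ioo le_rfl hr.le) isOpen_Ioo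
  obtain ⟨y, hyC, hys⟩ := (hC.infinite.sdiff (finite_singleton (γ s))).nonempty
  obtain ⟨z, hz, hz', hz''⟩ := hC.isPreconnected _ _ ho isOpen_compl_singleton
    (fun x hx => by
      by_cases hxs : x = γ s
      · exact Or.inl ⟨s, ⟨hs, hsr⟩, hxs.symm⟩
      · exact Or.inr hxs) ⟨γ s, hsC, s, ⟨hs, hsr⟩, rfl⟩ ⟨y, hyC, hys⟩
  obtain ⟨t, ht, rfl⟩ := hz'
  exact hz'' (by rw [hD t ht.1 ht.2 hz]; rfl)

/-- A circle that meets an open arc contains it. -/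
theorem IsTopCircle.image_Ioo_subset [T2Space X] {C : Set X} (hC : IsTopCircle C) {γ : ℝ → X}
    (h : IsOpenArc γ) {s : ℝ} (hs : s ∈ Ioo (0 : ℝ) 1) (hsC : γ s ∈ C) : γ '' Ioo 0 1 ⊆ C := by
  rintro _ ⟨r, hr, rfl⟩
  rcases lt_trichotomy s r with h' | rfl | h'
  · exact hC.mem_of_lt h hs.1 h' hr.2 hsC
  · exact hsC
  · have := hC.mem_of_lt h.symm (s := 1 - s) (r := 1 - r) (by linarith [hs.2]) (by linarith)
      (by linarith [hr.1]) (by simpa using hsC)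
    simpa using this

end TopologicalArcs

namespace SimpleGraph

namespace EndSpace

/-! ### Edges as curves, and continuous functions on |G| -/

section Basic

variable {V : Type*} {G : SimpleGraph V}

theorem edgePath_zero (e : G.edgeSet) : edgePath e 0 = vert (Quot.out e.1).1 := by
  simp [edgePath]

theorem edgePath_one (e : G.edgeSet) : edgePath e 1 = vert (Quot.out e.1).2 := by
  simp [edgePath]

theorem edgePath_of_mem (e : G.edgeSet) {t : ℝ} (ht : t ∈ Ioo (0 : ℝ) 1) :
    edgePath e ⟨t, ht.1.le, ht.2.le⟩ = inner e ⟨t, ht⟩ := by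
  have h0 : (⟨t, ht.1.le, ht.2.le⟩ : unitInterval) ≠ 0 := fun h =>
    ht.1.ne' (congrArg Subtype.val h)
  have h1 : (⟨t, ht.1.le, ht.2.le⟩ : unitInterval) ≠ 1 := fun h =>
    ht.2.ne (congrArg Subtype.val h)
  simp [edgePath, h0, h1]

theorem mk_out (e : G.edgeSet) : s((Quot.out e.1).1, (Quot.out e.1).2) = e.1 := Quot.out_eq e.1

theorem adj_out (e : G.edgeSet) : G.Adj (Quot.out e.1).1 (Quot.out e.1).2 := by
  rw [← mem_edgeSet, mk_out]; exact e.2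

theorem mem_edge_iff (e : G.edgeSet) (v : V) :
    v ∈ e.1 ↔ v = (Quot.out e.1).1 ∨ v = (Quot.out e.1).2 := by
  conv_lhs => rw [← mk_out e]
  exact Sym2.mem_iff

theorem unitInterval_cases {p : unitInterval → Prop} (h0 : p 0) (h1 : p 1)
    (h : ∀ t (ht : t ∈ Ioo (0 : ℝ) 1), p ⟨t, ht.1.le, ht.2.le⟩) (t : unitInterval) : p t := by
  by_cases h0' : t = 0
  · rwa [h0']
  by_cases h1' : t = 1
  · rwa [h1']
  exact h t ⟨unitInterval.pos_iff_ne_zero.mpr h0', unitInterval.lt_one_iff_ne_one.mpr h1'⟩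

theorem edgePath_injective (e : G.edgeSet) : Function.Injective (edgePath e) := by
  have hne := (adj_out e).ne
  intro s t
  induction s using unitInterval_cases with
  | h0 =>
    induction t using unitInterval_cases with
    | h0 => simp
    | h1 => simp [edgePath_zero, edgePath_one, hne]
    | h t ht => simp [edgePath_zero, edgePath_of_mem e ht]
  | h1 =>
    induction t using unitInterval_cases with
    | h0 => simp [edgePath_zero, edgePath_one, hne.symm]
    | h1 => simp
    | h t ht => simp [edgePath_one, edgePath_of_mem e ht]
  | h s hs =>
    induction t using unitInterval_cases with
    | h0 => simp [edgePath_zero, edgePath_of_mem e hs]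
    | h1 => simp [edgePath_one, edgePath_of_mem e hs]
    | h t ht =>
      rw [edgePath_of_mem e hs, edgePath_of_mem e ht]
      intro h
      exact Subtype.ext (by simpa using h)

theorem continuous_edgePath (e : G.edgeSet) : Continuous (edgePath e) :=
  ⟨fun _ hU => hU.1 e⟩

theorem inner_mem_range_edgePath {e e' : G.edgeSet} {t : Ioo (0 : ℝ) 1} :
    inner e' t ∈ range (edgePath e) ↔ e' = e := by
  constructor
  · rintro ⟨s, hs⟩
    induction s using unitInterval_cases with
    | h0 => simp [edgePath_zero] at hs
    | h1 => simp [edgePath_one] at hs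
    | h s hs' =>
      rw [edgePath_of_mem e hs'] at hs
      simp only [inner.injEq] at hs
      exact hs.1.symm
  · rintro rfl
    exact ⟨_, edgePath_of_mem e' t.2⟩

theorem vert_mem_range_edgePath {e : G.edgeSet} {v : V} :
    vert v ∈ range (edgePath e) ↔ v ∈ e.1 := by
  rw [mem_edge_iff]
  constructor
  · rintro ⟨s, hs⟩
    induction s using unitInterval_cases with
    | h0 => rw [edgePath_zero] at hs; exact Or.inl (vert.inj hs).symm
    | h1 => rw [edgePath_one] at hs; exact Or.inr (vert.inj hs).symm
    | h s hs' => rw [edgePath_of_mem e hs'] at hs; simp at hs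
  · rintro (rfl | rfl)
    · exact ⟨0, edgePath_zero e⟩
    · exact ⟨1, edgePath_one e⟩

theorem atEnd_notMem_range_edgePath {e : G.edgeSet} {ω : G.end} :
    atEnd ω ∉ range (edgePath e) := by
  rintro ⟨s, hs⟩
  induction s using unitInterval_cases with
  | h0 => simp [edgePath_zero] at hs
  | h1 => simp [edgePath_one] at hs
  | h s hs' => simp [edgePath_of_mem e hs'] at hs

/-- The parametrisation of the closed edge `e`, as a function of a real variable. -/
noncomputable def edgeCurve (e : G.edgeSet) (t : ℝ) : G.EndSpace :=
  edgePath e (projIcc 0 1 zero_le_one t)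

theorem edgeCurve_of_mem_Icc (e : G.edgeSet) {t : ℝ} (ht : t ∈ Icc (0 : ℝ) 1) :
    edgeCurve e t = edgePath e ⟨t, ht⟩ := by
  rw [edgeCurve, projIcc_of_mem zero_le_one ht]

theorem edgeCurve_of_mem_Ioo (e : G.edgeSet) {t : ℝ} (ht : t ∈ Ioo (0 : ℝ) 1) :
    edgeCurve e t = inner e ⟨t, ht⟩ := by
  rw [edgeCurve_of_mem_Icc e ⟨ht.1.le, ht.2.le⟩, edgePath_of_mem e ht]

theorem edgeCurve_zero (e : G.edgeSet) : edgeCurve e 0 = vert (Quot.out e.1).1 := by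
  rw [edgeCurve, projIcc_left]; exact edgePath_zero e

theorem edgeCurve_one (e : G.edgeSet) : edgeCurve e 1 = vert (Quot.out e.1).2 := by
  rw [edgeCurve, projIcc_right]; exact edgePath_one e

theorem continuous_edgeCurve (e : G.edgeSet) : Continuous (edgeCurve e) :=
  (continuous_edgePath e).comp continuous_projIcc

theorem injOn_edgeCurve (e : G.edgeSet) : InjOn (edgeCurve e) (Icc 0 1) := by
  intro s hs t ht h
  rw [edgeCurve_of_mem_Icc e hs, edgeCurve_of_mem_Icc e ht] at h
  exact congrArg Subtype.val (edgePath_injective e h)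

theorem isOpenArc_edgeCurve (e : G.edgeSet) : IsOpenArc (edgeCurve e) := by
  refine ⟨(continuous_edgeCurve e).continuousOn, (injOn_edgeCurve e).mono Ioo_subset_Icc_self,
    fun U hU hU' => ⟨fun e' => ?_, fun ω hω => ?_⟩⟩
  · by_cases h : e' = e
    · subst h
      convert hU'.preimage continuous_subtype_val using 1
      ext t
      constructor
      · rintro ⟨s, hs, hst⟩
        rw [edgeCurve_of_mem_Icc e' (Ioo_subset_Icc_self (hU hs))] at hst
        rw [← edgePath_injective e' hst]
        exact hs
      · intro ht
        exact ⟨t, ht, edgeCurve_of_mem_Icc e' t.2⟩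
    · convert isOpen_empty
      refine eq_empty_of_forall_notMem fun t => ?_
      rintro ⟨s, hs, hst⟩
      rw [edgeCurve_of_mem_Ioo e (hU hs)] at hst
      exact h (inner_mem_range_edgePath.mp ⟨t, hst.symm⟩).symm
  · obtain ⟨s, hs, hst⟩ := hω
    rw [edgeCurve_of_mem_Ioo e (hU hs)] at hst
    simp at hst

/-- The closed edge `e`, parametrised from its endvertex `v`. -/
noncomputable def curveFrom (e : G.edgeSet) (v : V) (t : ℝ) : G.EndSpace :=
  open Classical in if v = (Quot.out e.1).1 then edgeCurve e t else edgeCurve e (1 - t)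

theorem curveFrom_eq (e : G.edgeSet) (v : V) :
    curveFrom e v = edgeCurve e ∨ curveFrom e v = fun t => edgeCurve e (1 - t) := by
  by_cases h : v = (Quot.out e.1).1
  · exact Or.inl (funext fun t => if_pos h)
  · exact Or.inr (funext fun t => if_neg h)

theorem curveFrom_zero {e : G.edgeSet} {v : V} (hv : v ∈ e.1) : curveFrom e v 0 = vert v := by
  rw [curveFrom]
  split_ifs with h
  · rw [edgeCurve_zero, h]
  · rw [sub_zero, edgeCurve_one, ((mem_edge_iff e v).mp hv).resolve_left h]

theorem curveFrom_one {e : G.edgeSet} {v w : V} (h : e.1 = s(v, w)) :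
    curveFrom e v 1 = vert w := by
  have hvw : G.Adj v w := by rw [← mem_edgeSet, ← h]; exact e.2
  have hw := (mem_edge_iff e w).mp (h ▸ Sym2.mem_mk_right v w)
  have hv := (mem_edge_iff e v).mp (h ▸ Sym2.mem_mk_left v w)
  rw [curveFrom]
  split_ifs with h'
  · rw [edgeCurve_one, hw.resolve_left (h' ▸ hvw.ne')]
  · rw [sub_self, edgeCurve_zero,
      hw.resolve_right (hv.resolve_left h' ▸ hvw.ne')]

theorem continuous_curveFrom (e : G.edgeSet) (v : V) : Continuous (curveFrom e v) := by
  rcases curveFrom_eq e v with h | h <;> rw [h]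
  · exact continuous_edgeCurve e
  · exact (continuous_edgeCurve e).comp (by fun_prop)

theorem injOn_curveFrom (e : G.edgeSet) (v : V) : InjOn (curveFrom e v) (Icc 0 1) := by
  rcases curveFrom_eq e v with h | h <;> rw [h]
  · exact injOn_edgeCurve e
  · intro s hs t ht hst
    linarith [injOn_edgeCurve e ⟨by linarith [hs.2], by linarith [hs.1]⟩
      ⟨by linarith [ht.2], by linarith [ht.1]⟩ hst]

theorem isOpenArc_curveFrom (e : G.edgeSet) (v : V) : IsOpenArc (curveFrom e v) := by
  rcases curveFrom_eq e v with h | h <;> rw [h]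
  · exact isOpenArc_edgeCurve e
  · exact (isOpenArc_edgeCurve e).symm

theorem curveFrom_mem_Ioo (e : G.edgeSet) (v : V) {t : ℝ} (ht : t ∈ Ioo (0 : ℝ) 1) :
    ∃ t', curveFrom e v t = inner e t' := by
  rcases curveFrom_eq e v with h | h <;> rw [h]
  · exact ⟨_, edgeCurve_of_mem_Ioo e ht⟩
  · exact ⟨_, edgeCurve_of_mem_Ioo e ⟨by linarith [ht.2], by linarith [ht.1]⟩⟩

theorem exists_curveFrom_eq_inner (e : G.edgeSet) (v : V) (t : Ioo (0 : ℝ) 1) :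
    ∃ t' ∈ Ioo (0 : ℝ) 1, curveFrom e v t' = inner e t := by
  rcases curveFrom_eq e v with h | h <;> rw [h]
  · exact ⟨t, t.2, edgeCurve_of_mem_Ioo e t.2⟩
  · refine ⟨1 - t, ⟨by linarith [t.2.2], by linarith [t.2.1]⟩, ?_⟩
    simp only [sub_sub_cancel]
    exact edgeCurve_of_mem_Ioo e t.2

theorem image_curveFrom_Icc (e : G.edgeSet) (v : V) :
    curveFrom e v '' Icc 0 1 = range (edgePath e) := by
  have h0 : edgeCurve e '' Icc 0 1 = range (edgePath e) := by
    ext z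
    constructor
    · rintro ⟨t, ht, rfl⟩; exact ⟨_, (edgeCurve_of_mem_Icc e ht).symm⟩
    · rintro ⟨t, rfl⟩; exact ⟨t, t.2, edgeCurve_of_mem_Icc e t.2⟩
  rcases curveFrom_eq e v with h | h <;> rw [h]
  · exact h0
  · rw [← h0, ← image_image (edgeCurve e) (fun t => 1 - t)]
    simp

theorem continuous_of_edgePath {Y : Type*} [TopologicalSpace Y] {F : G.EndSpace → Y}
    (h : ∀ e, Continuous (F ∘ edgePath e))
    (h' : ∀ ω, ∀ U, IsOpen U → F (atEnd ω) ∈ U → ∃ S, ContainsComponent (F ⁻¹' U) S ω) :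
    Continuous F :=
  ⟨fun U hU => ⟨fun e => hU.preimage (h e), fun ω hω => h' ω U hU hω⟩⟩

/-- The function on `|G|` that is `h` on the vertices, affine on the edges, and `c` at the ends. -/
noncomputable def linExt (h : V → ℝ) (c : ℝ) : G.EndSpace → ℝ
  | vert v => h v
  | inner e t => (1 - t) * h (Quot.out e.1).1 + t * h (Quot.out e.1).2
  | atEnd _ => c

theorem linExt_edgePath (h : V → ℝ) (c : ℝ) (e : G.edgeSet) (t : unitInterval) :
    linExt h c (edgePath e t) = (1 - t) * h (Quot.out e.1).1 + t * h (Quot.out e.1).2 := by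
  induction t using unitInterval_cases with
  | h0 => simp [edgePath_zero, linExt]
  | h1 => simp [edgePath_one, linExt]
  | h t ht => rw [edgePath_of_mem e ht]; rfl

/-- Deleting the finitely many vertices whose value differs from `c` by at least ε leaves components
on which all vertex values, and by convexity all values on edges, are ε-close to `c`. -/
theorem continuous_linExt {h : V → ℝ} {c : ℝ} (hc : ∀ ε > 0, {v | ε ≤ |h v - c|}.Finite) :
    Continuous (linExt (G := G) h c) := by
  refine continuous_of_edgePath (fun e => ?_) fun ω U hU hω => ?_
  · simp only [Function.comp_def, linExt_edgePath]
    fun_prop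
  · obtain ⟨ε, hε, hεU⟩ := Metric.isOpen_iff.mp hU c hω
    have hS : ∀ v ∈ G.endComponent (hc ε hε).toFinset ω, |h v - c| < ε := by
      intro v hv
      have := ComponentCompl.notMem_of_mem hv
      simpa using this
    refine ⟨(hc ε hε).toFinset, fun v hv => hεU ?_, fun e t he => hεU ?_, fun _ _ => hω⟩
    · exact hS v hv
    · have h1 := abs_lt.mp (hS _ (he _ ((mem_edge_iff e _).mpr (Or.inl rfl))))
      have h2 := abs_lt.mp (hS _ (he _ ((mem_edge_iff e _).mpr (Or.inr rfl))))
      have h0 := t.2.1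
      have h1' := t.2.2
      rw [Metric.mem_ball, Real.dist_eq, abs_lt]
      simp only [linExt]
      constructor <;> nlinarith

/-- The function on `|G|` that is `g` on the edge `e` and zero elsewhere. -/
noncomputable def edgeBump (e : G.edgeSet) (g : ℝ → ℝ) : G.EndSpace → ℝ
  | vert _ => 0
  | inner e' t => open Classical in if e' = e then g t else 0
  | atEnd _ => 0

theorem edgeBump_edgePath {e : G.edgeSet} {g : ℝ → ℝ} (h0 : g 0 = 0) (h1 : g 1 = 0)
    (t : unitInterval) : edgeBump e g (edgePath e t) = g t := by
  induction t using unitInterval_cases with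
  | h0 => simp [edgePath_zero, edgeBump, h0]
  | h1 => simp [edgePath_one, edgeBump, h1]
  | h t ht => simp [edgePath_of_mem e ht, edgeBump]

theorem edgeBump_edgePath_of_ne {e e' : G.edgeSet} (h : e' ≠ e) (g : ℝ → ℝ)
    (t : unitInterval) : edgeBump e g (edgePath e' t) = 0 := by
  induction t using unitInterval_cases with
  | h0 => simp [edgePath_zero, edgeBump]
  | h1 => simp [edgePath_one, edgeBump]
  | h t ht => simp [edgePath_of_mem e' ht, edgeBump, h]

theorem continuous_edgeBump {e : G.edgeSet} {g : ℝ → ℝ} (h0 : g 0 = 0) (h1 : g 1 = 0)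
    (hg : Continuous g) : Continuous (edgeBump e g) := by
  classical
  refine continuous_of_edgePath (fun e' => ?_) fun ω U hU hω => ?_
  · by_cases h : e' = e
    · subst h
      simp only [Function.comp_def, edgeBump_edgePath h0 h1]
      fun_prop
    · simp only [Function.comp_def, edgeBump_edgePath_of_ne h]
      fun_prop
  -- Deleting a single endvertex of `e` already keeps `e` out of every component.
  · refine ⟨{(Quot.out e.1).1}, fun v hv => hω, fun e' t he => ?_, fun _ _ => hω⟩
    have hne : e' ≠ e := by
      rintro rfl
      have := ComponentCompl.notMem_of_mem (he _ ((mem_edge_iff e' _).mpr (Or.inl rfl)))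
      simp at this
    simpa [edgeBump, hne] using hω

end Basic

end EndSpace

end SimpleGraph

namespace SimpleGraph

theorem finite_setOf_mem_edge {V : Type*} {G : SimpleGraph V} {v : V}
    (h : (G.neighborSet v).Finite) : {e : G.edgeSet | v ∈ e.1}.Finite := by
  have h1 : ((fun w => s(v, w)) '' G.neighborSet v).Finite := h.image _
  refine Finite.of_finite_image (f := Subtype.val) (h1.subset ?_) Subtype.val_injective.injOn
  rintro _ ⟨e, he, rfl⟩
  obtain ⟨w, hw⟩ := Sym2.mem_iff_exists.mp he
  exact ⟨w, by rw [mem_neighborSet, ← mem_edgeSet, ← hw]; exact e.2, hw.symm⟩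

namespace EndSpace

/-! ### Separating points by functions Lipschitz along edges -/

section Separation

variable {V : Type*} {G : SimpleGraph V}

/-- `φ` is continuous and `K`-Lipschitz along each edge `e`, as an interval of length `ℓ e`. -/
structure IsEdgeLipschitz (ℓ : G.edgeSet → ℝ) (K : ℝ) (φ : G.EndSpace → ℝ) : Prop where
  pos : 0 < K
  continuous : Continuous φ
  le : ∀ e s t, |φ (edgePath e s) - φ (edgePath e t)| ≤ K * ℓ e * |(s : ℝ) - t|

theorem isEdgeLipschitz_edgeBump {ℓ : G.edgeSet → ℝ} (hℓ : ∀ e, 0 < ℓ e) (e : G.edgeSet)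
    {g : ℝ → ℝ} (h0 : g 0 = 0) (h1 : g 1 = 0) (hg : Continuous g)
    (hL : ∀ s ∈ Icc (0 : ℝ) 1, ∀ t ∈ Icc (0 : ℝ) 1, |g s - g t| ≤ |s - t|) :
    IsEdgeLipschitz ℓ (ℓ e)⁻¹ (edgeBump e g) := by
  have hK : 0 < (ℓ e)⁻¹ := inv_pos.mpr (hℓ e)
  refine ⟨hK, continuous_edgeBump h0 h1 hg, fun e' s t => ?_⟩
  by_cases h : e' = e
  · subst h
    rw [edgeBump_edgePath h0 h1, edgeBump_edgePath h0 h1, inv_mul_cancel₀ (hℓ e').ne', one_mul]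
    exact hL s s.2 t t.2
  · rw [edgeBump_edgePath_of_ne h, edgeBump_edgePath_of_ne h, sub_self, abs_zero]
    have := (hℓ e').le
    positivity

theorem abs_linExt_edgePath_sub (h : V → ℝ) (c : ℝ) (e : G.edgeSet) (s t : unitInterval) :
    |linExt h c (edgePath e s) - linExt h c (edgePath e t)| =
      |h (Quot.out e.1).1 - h (Quot.out e.1).2| * |(s : ℝ) - t| := by
  rw [linExt_edgePath, linExt_edgePath, abs_sub_comm (s : ℝ), ← abs_mul]
  congr 1
  ring

theorem continuous_linExt_indicator (v : V) :
    Continuous (linExt (G := G) (fun w => open Classical in if w = v then (1 : ℝ) else 0) 0) := by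
  refine continuous_linExt fun ε hε => (finite_singleton v).subset fun w hw => ?_
  by_contra hne
  have hne : w ≠ v := hne
  simp only [hne, if_false, sub_zero, abs_zero, mem_ofPred_eq] at hw
  exact absurd hε (not_lt.mpr hw)

/-- The function is constant along edges that avoid `v` and changes by 1 along each of the finitely
many edges at `v`; the largest inverse length among those bounds the slope. -/
theorem exists_isEdgeLipschitz_linExt {ℓ : G.edgeSet → ℝ} (hℓ : ∀ e, 0 < ℓ e) {v : V}
    (hv : (G.neighborSet v).Finite) :
    ∃ K, IsEdgeLipschitz ℓ K
      (linExt (fun w => open Classical in if w = v then (1 : ℝ) else 0) 0) := by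
  classical
  obtain ⟨K, hK⟩ := ((finite_setOf_mem_edge hv).image fun e => (ℓ e)⁻¹).bddAbove
  refine ⟨max K 1, lt_max_of_lt_right one_pos, continuous_linExt_indicator v, fun e s t => ?_⟩
  · rw [abs_linExt_edgePath_sub]
    refine mul_le_mul_of_nonneg_right ?_ (abs_nonneg _)
    by_cases h : v ∈ e.1
    · have h1 : 1 ≤ max K 1 * ℓ e := by
        rw [← inv_mul_cancel₀ (hℓ e).ne']
        exact mul_le_mul_of_nonneg_right
          ((hK (mem_image_of_mem _ h)).trans (le_max_left _ _)) (hℓ e).le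
      refine le_trans ?_ h1
      split_ifs <;> simp
    · rw [mem_edge_iff, not_or] at h
      rw [if_neg (Ne.symm h.1), if_neg (Ne.symm h.2), sub_self, abs_zero]
      exact mul_nonneg (zero_le_one.trans (le_max_right _ _)) (hℓ e).le

/-- Inner points are separated by bumps on their edge, vertices by tent functions. Two distinct ends
would need another argument, but there is at most one. Through the bound on `arcDist` these
functions show that distinct points have positive distance. -/
theorem exists_isEdgeLipschitz_ne [Subsingleton G.end] (hG : ∀ v, (G.neighborSet v).Finite)
    {ℓ : G.edgeSet → ℝ} (hℓ : ∀ e, 0 < ℓ e) {x y : G.EndSpace} (hxy : x ≠ y) :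
    ∃ K φ, IsEdgeLipschitz ℓ K φ ∧ φ x ≠ φ y := by
  classical
  have key : ∀ (e : G.edgeSet) (t : Ioo (0 : ℝ) 1) (z : G.EndSpace), inner e t ≠ z →
      ∃ K φ, IsEdgeLipschitz ℓ K φ ∧ φ (inner e t) ≠ φ z := by
    intro e t z hz
    -- The first bump confuses `t` with `1 - t`. The second is `t` times the first, so points of the
    -- edge on which both agree coincide.
    have L1 := isEdgeLipschitz_edgeBump hℓ e (g := fun t => t * (1 - t)) (by simp) (by simp)
      (by fun_prop) (by
        intro s hs t ht
        have : s * (1 - s) - t * (1 - t) = (1 - s - t) * (s - t) := by ring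
        rw [this, abs_mul]
        refine mul_le_of_le_one_left (abs_nonneg _) (abs_le.mpr ⟨?_, ?_⟩) <;>
          linarith [hs.1, hs.2, ht.1, ht.2])
    have L2 := isEdgeLipschitz_edgeBump hℓ e (g := fun t => t ^ 2 * (1 - t)) (by simp) (by simp)
      (by fun_prop) (by
        intro s hs t ht
        have : s ^ 2 * (1 - s) - t ^ 2 * (1 - t) = (s + t - s ^ 2 - s * t - t ^ 2) * (s - t) := by
          ring
        rw [this, abs_mul]
        refine mul_le_of_le_one_left (abs_nonneg _) (abs_le.mpr ⟨?_, ?_⟩) <;>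
          nlinarith [hs.1, hs.2, ht.1, ht.2, mul_nonneg hs.1 ht.1, mul_nonneg hs.1
            (sub_nonneg.mpr hs.2), mul_nonneg ht.1 (sub_nonneg.mpr ht.2), mul_nonneg hs.1
            (sub_nonneg.mpr ht.2), mul_nonneg ht.1 (sub_nonneg.mpr hs.2)])
    have hp : 0 < (t : ℝ) * (1 - t) := mul_pos t.2.1 (sub_pos.mpr t.2.2)
    by_cases h1 : edgeBump e (fun t => t * (1 - t)) (inner e t) =
        edgeBump e (fun t => t * (1 - t)) z
    · cases z with
      | vert v => simp only [edgeBump, if_true] at h1; exact absurd h1 hp.ne'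
      | atEnd ω => simp only [edgeBump, if_true] at h1; exact absurd h1 hp.ne'
      | inner e' s =>
        simp only [edgeBump, if_true] at h1
        split_ifs at h1 with h
        · subst h
          refine ⟨_, _, L2, fun h2 => hz ?_⟩
          simp only [edgeBump, if_true] at h2
          have : (t : ℝ) = s := by
            have h3 : (t : ℝ) * (t * (1 - t)) = s * (t * (1 - t)) := by
              linear_combination h2 - (s : ℝ) * h1
            exact mul_right_cancel₀ hp.ne' h3
          rw [Subtype.ext this]
        · exact absurd h1 hp.ne'
    · exact ⟨_, _, L1, h1⟩
  have key' : ∀ (v : V) (z : G.EndSpace), (∀ e t, z ≠ inner e t) → vert v ≠ z →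
      ∃ K φ, IsEdgeLipschitz ℓ K φ ∧ φ (vert v) ≠ φ z := by
    intro v z hz hvz
    obtain ⟨K, hK⟩ := exists_isEdgeLipschitz_linExt hℓ (hG v)
    refine ⟨K, _, hK, ?_⟩
    cases z with
    | vert w =>
      have : w ≠ v := fun h => hvz (h ▸ rfl)
      simp [linExt, this]
    | inner e t => exact (hz e t rfl).elim
    | atEnd ω => simp [linExt]
  have symm : ∀ {x y : G.EndSpace}, (∃ K φ, IsEdgeLipschitz ℓ K φ ∧ φ x ≠ φ y) →
      ∃ K φ, IsEdgeLipschitz ℓ K φ ∧ φ y ≠ φ x :=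
    fun ⟨K, φ, h, hne⟩ => ⟨K, φ, h, hne.symm⟩
  cases x with
  | inner e t => exact key e t y hxy
  | vert v =>
    cases y with
    | inner e t => exact symm (key e t _ hxy.symm)
    | vert w => exact key' v _ (by simp) hxy
    | atEnd ω => exact key' v _ (by simp) hxy
  | atEnd ω =>
    cases y with
    | inner e t => exact symm (key e t _ hxy.symm)
    | vert w => exact symm (key' w _ (by simp) hxy.symm)
    | atEnd ω' => exact absurd (congrArg atEnd (Subsingleton.elim ω ω')) hxy

theorem t2Space_of_subsingleton_end [Subsingleton G.end] (hG : ∀ v, (G.neighborSet v).Finite) :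
    T2Space G.EndSpace := by
  refine ⟨fun x y hxy => ?_⟩
  obtain ⟨K, φ, hφ, hne⟩ := exists_isEdgeLipschitz_ne hG (ℓ := fun _ => 1)
    (fun _ => one_pos) hxy
  exact separated_by_continuous hφ.continuous hne

end Separation

/-! ### Lengths of arcs and the distance function -/

section Length

variable {V : Type*} {G : SimpleGraph V} {ℓ : G.edgeSet → ℝ}

theorem length_mono {A B : Set G.EndSpace} (h : A ⊆ B) : length ℓ A ≤ length ℓ B :=
  ENNReal.tsum_le_tsum fun _ => mul_le_mul_right
    (MeasureTheory.measure_mono fun _ hx => hx.imp fun _ hA => h hA) _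

theorem length_union_le (A B : Set G.EndSpace) : length ℓ (A ∪ B) ≤ length ℓ A + length ℓ B := by
  rw [length, length, length, ← ENNReal.tsum_add]
  refine ENNReal.tsum_le_tsum fun e => ?_
  rw [← mul_add]
  refine mul_le_mul_right (le_trans (MeasureTheory.measure_mono ?_)
    (MeasureTheory.measure_union_le _ _)) _
  rintro t ⟨ht, h | h⟩
  · exact Or.inl ⟨ht, h⟩
  · exact Or.inr ⟨ht, h⟩

theorem length_edgeCurve_image_le (hℓ : ∀ e, 0 < ℓ e) (e : G.edgeSet) {s t : ℝ} (hs : 0 ≤ s)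
    (ht : t ≤ 1) :
    length ℓ (edgeCurve e '' Icc s t) ≤ ENNReal.ofReal (ℓ e * (t - s)) := by
  have hsub : Icc s t ⊆ Icc 0 1 := Icc_subset_Icc hs ht
  rw [length, tsum_eq_single e, ENNReal.ofReal_mul (hℓ e).le, ← Real.volume_Icc]
  · refine mul_le_mul_right (MeasureTheory.measure_mono ?_) _
    rintro u ⟨hu, r, hr, hru⟩
    rw [← edgeCurve_of_mem_Ioo e hu] at hru
    rw [← injOn_edgeCurve e (hsub hr) (Ioo_subset_Icc_self hu) hru]
    exact hr
  · intro e' he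
    have : {u : ℝ | ∃ hu : u ∈ Ioo (0 : ℝ) 1, inner e' ⟨u, hu⟩ ∈ edgeCurve e '' Icc s t} = ∅ := by
      refine eq_empty_of_forall_notMem ?_
      rintro u ⟨hu, r, hr, hru⟩
      rw [edgeCurve_of_mem_Icc e (hsub hr)] at hru
      exact he (inner_mem_range_edgePath.mp ⟨_, hru⟩)
    rw [this, MeasureTheory.measure_empty, mul_zero]

/-- Arcs as injective paths on real intervals: the degenerate interval accounts for single points,
so that reversing and concatenating need no case distinction. -/
theorem isArc_iff [T2Space G.EndSpace] {x y : G.EndSpace} {A : Set G.EndSpace} :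
    IsArc x y A ↔ ∃ (f : ℝ → G.EndSpace) (a b : ℝ), a ≤ b ∧ ContinuousOn f (Icc a b) ∧
      InjOn f (Icc a b) ∧ f a = x ∧ f b = y ∧ f '' Icc a b = A := by
  constructor
  · rintro (⟨rfl, rfl⟩ | ⟨f, hf, rfl, rfl, rfl⟩)
    · exact ⟨fun _ => x, 0, 0, le_rfl, continuousOn_const, by simp [InjOn], rfl, rfl, by simp⟩
    · refine ⟨fun t => f (projIcc 0 1 zero_le_one t), 0, 1, zero_le_one,
        (hf.continuous.comp continuous_projIcc).continuousOn, fun s hs t ht hst => ?_, ?_, ?_, ?_⟩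
      · have := hf.injective hst
        rw [projIcc_of_mem _ hs, projIcc_of_mem _ ht] at this
        exact congrArg Subtype.val this
      · simp only [projIcc_left]; rfl
      · simp only [projIcc_right]; rfl
      · ext z
        constructor
        · rintro ⟨t, -, rfl⟩; exact mem_range_self _
        · rintro ⟨t, rfl⟩; exact ⟨t, t.2, by simp⟩
  · rintro ⟨f, a, b, hab, hc, hi, rfl, rfl, rfl⟩
    rcases hab.eq_or_lt with rfl | hab
    · exact Or.inl ⟨rfl, by simp⟩
    · exact Or.inr (exists_isEmbedding_unitInterval_of_Icc hab hc hi)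

theorem IsArc.symm [T2Space G.EndSpace] {x y : G.EndSpace} {A : Set G.EndSpace}
    (h : IsArc x y A) : IsArc y x A := by
  obtain ⟨f, a, b, hab, hc, hi, rfl, rfl, rfl⟩ := isArc_iff.mp h
  have hm : ∀ t ∈ Icc (-b) (-a), -t ∈ Icc a b := fun t ht =>
    ⟨by linarith [ht.2], by linarith [ht.1]⟩
  refine isArc_iff.mpr ⟨fun t => f (-t), -b, -a, by linarith, hc.comp (by fun_prop) hm,
    fun s hs t ht hst => ?_, by simp, by simp, ?_⟩
  · linarith [hi (hm s hs) (hm t ht) hst]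
  · rw [← image_image f (fun t => -t)]
    simp

theorem IsArc.exists_trans [T2Space G.EndSpace] {x y z : G.EndSpace} {A B : Set G.EndSpace}
    (hA : IsArc x y A) (hB : IsArc y z B) : ∃ D ⊆ A ∪ B, IsArc x z D := by
  obtain ⟨f, a, b, hab, hc, hi, rfl, rfl, rfl⟩ := isArc_iff.mp hA
  obtain ⟨g, c, d, hcd, hc', hi', h, rfl, rfl⟩ := isArc_iff.mp hB
  obtain ⟨k, e, hae, hk, hki, h1, h2, h3, -⟩ := exists_arc_trans hab hcd hc hi hc' hi' h.symm
  exact ⟨_, h3, isArc_iff.mpr ⟨k, a, e, hae, hk, hki, h1, h2, rfl⟩⟩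

theorem IsArc.union [T2Space G.EndSpace] {x y z : G.EndSpace} {A B : Set G.EndSpace}
    (hA : IsArc x y A) (hB : IsArc y z B) (hAB : A ∩ B ⊆ {y}) : IsArc x z (A ∪ B) := by
  obtain ⟨f, a, b, hab, hc, hi, rfl, rfl, rfl⟩ := isArc_iff.mp hA
  obtain ⟨g, c, d, hcd, hc', hi', h, rfl, rfl⟩ := isArc_iff.mp hB
  obtain ⟨k, e, hae, hk, hki, h1, h2, -, h3⟩ := exists_arc_trans hab hcd hc hi hc' hi' h.symm
  exact isArc_iff.mpr ⟨k, a, e, hae, hk, hki, h1, h2, h3 hAB⟩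

theorem IsArc.arcDist_le {x y : G.EndSpace} {A : Set G.EndSpace} (h : IsArc x y A) :
    arcDist ℓ x y ≤ length ℓ A :=
  iInf₂_le A h

theorem arcDist_self (x : G.EndSpace) : arcDist ℓ x x = 0 := by
  refine le_antisymm ((IsArc.arcDist_le (Or.inl ⟨rfl, rfl⟩)).trans_eq ?_) bot_le
  rw [length, ENNReal.tsum_eq_zero]
  intro e
  refine mul_eq_zero_of_right _ (Set.Countable.measure_zero ?_ _)
  refine Subsingleton.countable ?_
  rintro s ⟨hs, hs'⟩ t ⟨ht, ht'⟩
  have := (mem_singleton_iff.mp hs').trans (mem_singleton_iff.mp ht').symm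
  simpa using this

theorem arcDist_comm [T2Space G.EndSpace] (x y : G.EndSpace) :
    arcDist ℓ x y = arcDist ℓ y x :=
  le_antisymm (le_iInf₂ fun _ h => (IsArc.symm h).arcDist_le)
    (le_iInf₂ fun _ h => (IsArc.symm h).arcDist_le)

theorem arcDist_triangle [T2Space G.EndSpace] (x y z : G.EndSpace) :
    arcDist ℓ x z ≤ arcDist ℓ x y + arcDist ℓ y z := by
  conv_rhs => rw [arcDist, arcDist]
  simp only [ENNReal.iInf_add, ENNReal.add_iInf]
  refine le_iInf₂ fun A hA => le_iInf₂ fun B hB => ?_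
  obtain ⟨D, hD, h⟩ := IsArc.exists_trans hB hA
  refine h.arcDist_le.trans ((length_mono hD).trans (length_union_le _ _))

theorem arcDist_edgePath_le [T2Space G.EndSpace] (hℓ : ∀ e, 0 < ℓ e) (e : G.edgeSet)
    (s t : unitInterval) :
    arcDist ℓ (edgePath e s) (edgePath e t) ≤ ENNReal.ofReal (ℓ e * |(s : ℝ) - t|) := by
  wlog hst : s ≤ t generalizing s t
  · rw [arcDist_comm, abs_sub_comm]
    exact this t s (le_of_not_ge hst)
  have hst' : (s : ℝ) ≤ t := hst
  have hsub : Icc (s : ℝ) t ⊆ Icc 0 1 := Icc_subset_Icc s.2.1 t.2.2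
  rw [abs_sub_comm, abs_of_nonneg (sub_nonneg.mpr hst')]
  refine le_trans (IsArc.arcDist_le ?_)
    (length_edgeCurve_image_le hℓ e s.2.1 t.2.2)
  exact isArc_iff.mpr ⟨edgeCurve e, s, t, hst', (continuous_edgeCurve e).continuousOn,
    (injOn_edgeCurve e).mono hsub, edgeCurve_of_mem_Icc e s.2, edgeCurve_of_mem_Icc e t.2, rfl⟩

open MeasureTheory in
/-- An arc is at least as long as the variation between its endpoints of a function that is
`K`-Lipschitz along the edges that the arc meets. -/
theorem IsArc.ofReal_abs_sub_le [Countable V] [Countable G.end] {x y : G.EndSpace}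
    {A : Set G.EndSpace} (hA : IsArc x y A) {φ : G.EndSpace → ℝ} (hφ : Continuous φ) {K : ℝ}
    (hK : 0 ≤ K) (hℓ : ∀ e, 0 < ℓ e)
    (hL : ∀ e, (∃ t, inner e t ∈ A) → ∀ s t,
      |φ (edgePath e s) - φ (edgePath e t)| ≤ K * ℓ e * |(s : ℝ) - t|) :
    ENNReal.ofReal |φ x - φ y| ≤ ENNReal.ofReal K * length ℓ A := by
  rcases hA with ⟨rfl, rfl⟩ | ⟨f, hf, rfl, rfl, rfl⟩
  · simp
  set T : G.edgeSet → Set ℝ := fun e => {t | ∃ ht : t ∈ Ioo (0 : ℝ) 1, inner e ⟨t, ht⟩ ∈ range f}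
    with hT
  -- The image of the arc under `φ` is connected, so it covers the interval between the values at
  -- the endpoints.
  have h1 : ENNReal.ofReal |φ (f 0) - φ (f 1)| ≤ volume (φ '' range f) := by
    have hpc : IsPreconnected (φ '' range f) := by
      rw [← range_comp]
      exact isPreconnected_range (hφ.comp hf.continuous)
    rw [abs_sub_comm, ← Real.volume_interval]
    exact measure_mono (hpc.ordConnected.uIcc_subset ⟨_, mem_range_self 0, rfl⟩
      ⟨_, mem_range_self 1, rfl⟩)
  -- Vertices and ends contribute only countably many values, a null set, so the measure of the
  -- image comes from the edges alone.
  have h2 : φ '' range f ⊆ (range (φ ∘ vert) ∪ range (φ ∘ atEnd)) ∪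
      ⋃ e, (φ ∘ edgeCurve e) '' T e := by
    rintro _ ⟨z, hz, rfl⟩
    cases z with
    | vert v => exact Or.inl (Or.inl ⟨v, rfl⟩)
    | atEnd ω => exact Or.inl (Or.inr ⟨ω, rfl⟩)
    | inner e t =>
      exact Or.inr (mem_iUnion.mpr ⟨e, t, ⟨t.2, hz⟩, congrArg φ (edgeCurve_of_mem_Ioo e t.2)⟩)
  have h3 : ∀ e, volume ((φ ∘ edgeCurve e) '' T e) ≤
      ENNReal.ofReal K * (ENNReal.ofReal (ℓ e) * volume (T e)) := by
    intro e
    rcases (T e).eq_empty_or_nonempty with h | ⟨t₀, ht₀, h₀⟩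
    · simp [h]
    have hLip : LipschitzOnWith (K * ℓ e).toNNReal (φ ∘ edgeCurve e) (T e) := by
      refine LipschitzOnWith.of_dist_le_mul fun s hs t ht => ?_
      obtain ⟨hs, -⟩ := hs
      obtain ⟨ht, -⟩ := ht
      have := hL e ⟨_, h₀⟩ ⟨s, hs.1.le, hs.2.le⟩ ⟨t, ht.1.le, ht.2.le⟩
      rw [Real.coe_toNNReal _ (mul_nonneg hK (hℓ e).le), Real.dist_eq, Real.dist_eq]
      simpa only [Function.comp, edgeCurve_of_mem_Icc e ⟨hs.1.le, hs.2.le⟩,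
        edgeCurve_of_mem_Icc e ⟨ht.1.le, ht.2.le⟩] using this
    have := hLip.hausdorffMeasure_image_le zero_le_one
    rw [hausdorffMeasure_real, ENNReal.rpow_one] at this
    rwa [← mul_assoc, ← ENNReal.ofReal_mul hK]
  have h4 : volume (range (φ ∘ vert) ∪ range (φ ∘ (atEnd : G.end → G.EndSpace))) = 0 :=
    ((countable_range _).union (countable_range _)).measure_zero _
  calc ENNReal.ofReal |φ (f 0) - φ (f 1)| ≤ volume (φ '' range f) := h1
    _ ≤ _ := measure_mono h2
    _ ≤ _ := measure_union_le _ _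
    _ = volume (⋃ e, (φ ∘ edgeCurve e) '' T e) := by rw [h4, zero_add]
    _ ≤ ∑' e, volume ((φ ∘ edgeCurve e) '' T e) := measure_iUnion_le _
    _ ≤ ∑' e, ENNReal.ofReal K * (ENNReal.ofReal (ℓ e) * volume (T e)) :=
        ENNReal.tsum_le_tsum h3
    _ = ENNReal.ofReal K * length ℓ (range f) := by rw [ENNReal.tsum_mul_left]; rfl

theorem IsEdgeLipschitz.ofReal_abs_sub_le [Countable V] [Countable G.end] {K : ℝ}
    {φ : G.EndSpace → ℝ} (h : IsEdgeLipschitz ℓ K φ) (hℓ : ∀ e, 0 < ℓ e) (x y : G.EndSpace) :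
    ENNReal.ofReal |φ x - φ y| ≤ ENNReal.ofReal K * arcDist ℓ x y := by
  have h0 : ENNReal.ofReal K ≠ 0 := (ENNReal.ofReal_pos.mpr h.pos).ne'
  simp only [arcDist, ENNReal.mul_iInf_of_ne h0 ENNReal.ofReal_ne_top]
  exact le_iInf₂ fun A hA =>
    hA.ofReal_abs_sub_le h.continuous h.pos.le hℓ fun e _ => h.le e

end Length

end EndSpace

end SimpleGraph

/-! ### Circles and the parity of their degrees -/

/-- Let `c` be the parameter with `g c = γ (1 / 2)`. The open half `γ '' Ioo 0 (1 / 2)` is open, and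
its closure adds only the points `g 0` and `g c`. So `g` maps each of the two intervals left and
right of `c` either into this half or out of it. -/
theorem exists_ray_of_openArc {X : Type*} [TopologicalSpace X] [T2Space X] {g γ : ℝ → X}
    (hg : Continuous g) (hi : InjOn g (Ico 0 1)) (hγ : Continuous γ) (hγi : InjOn γ (Icc 0 1))
    (ho : IsOpenArc γ) (h0 : γ 0 = g 0) (hsub : γ '' Ioo 0 1 ⊆ g '' Ico 0 1) :
    ∃ c ∈ Ioo (0 : ℝ) 1, (∀ θ ∈ Ioo (0 : ℝ) 1, g θ ∈ γ '' Ioo 0 (1 / 2) ↔ θ < c) ∨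
      (∀ θ ∈ Ioo (0 : ℝ) 1, g θ ∈ γ '' Ioo 0 (1 / 2) ↔ c < θ) := by
  have hpt : ∀ t ∈ Ioo (0 : ℝ) 1, ∃ θ ∈ Ioo (0 : ℝ) 1, g θ = γ t := by
    intro t ht
    obtain ⟨θ, hθ, h⟩ := hsub ⟨t, ht, rfl⟩
    refine ⟨θ, ⟨hθ.1.lt_of_ne ?_, hθ.2⟩, h⟩
    rintro rfl
    exact ht.1.ne (hγi (left_mem_Icc.mpr zero_le_one) (Ioo_subset_Icc_self ht) (h0.trans h))
  obtain ⟨c, hc, hgc⟩ := hpt (1 / 2) (by norm_num)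
  have hcn : g c ∉ γ '' Ioo 0 (1 / 2) := by
    rintro ⟨t, ht, h⟩
    exact ht.2.ne (hγi ⟨ht.1.le, by linarith [ht.2]⟩ (by norm_num) (h.trans hgc))
  have hcl : IsClosed (γ '' Icc 0 (1 / 2)) := (isCompact_Icc.image hγ).isClosed
  have hop : IsOpen (γ '' Ioo 0 (1 / 2)) :=
    ho.isOpen_image _ (Ioo_subset_Ioo le_rfl (by norm_num)) isOpen_Ioo
  have key : ∀ I : Set ℝ, IsPreconnected I → I ⊆ Ioo 0 1 → c ∉ I →
      (∀ θ ∈ I, g θ ∈ γ '' Ioo 0 (1 / 2)) ∨ (∀ θ ∈ I, g θ ∉ γ '' Ioo 0 (1 / 2)) := by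
    intro I hI hI' hcI
    have hcov : g '' I ⊆ γ '' Ioo 0 (1 / 2) ∪ (γ '' Icc 0 (1 / 2))ᶜ := by
      rintro _ ⟨θ, hθ, rfl⟩
      by_cases hx : g θ ∈ γ '' Icc 0 (1 / 2)
      · obtain ⟨t, ht, hgt⟩ := hx
        refine Or.inl ⟨t, ⟨ht.1.lt_of_ne ?_, ht.2.lt_of_ne ?_⟩, hgt⟩
        · rintro rfl
          exact (hI' hθ).1.ne (hi ⟨le_rfl, one_pos⟩ (Ioo_subset_Ico_self (hI' hθ))
            (h0.symm.trans hgt))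
        · rintro rfl
          exact hcI (hi (Ioo_subset_Ico_self hc) (Ioo_subset_Ico_self (hI' hθ))
            (hgc.trans hgt) ▸ hθ)
      · exact Or.inr hx
    rcases (hI.image g hg.continuousOn).subset_or_subset hop hcl.isOpen_compl
      (disjoint_compl_right.mono_left (image_mono Ioo_subset_Icc_self)) hcov with h | h
    · exact Or.inl fun θ hθ => h ⟨θ, hθ, rfl⟩
    · exact Or.inr fun θ hθ hx => h ⟨θ, hθ, rfl⟩ (image_mono Ioo_subset_Icc_self hx)
  have hl := key (Ioo 0 c) isPreconnected_Ioo (Ioo_subset_Ioo le_rfl hc.2.le) (by simp)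
  have hr := key (Ioo c 1) isPreconnected_Ioo (Ioo_subset_Ioo hc.1.le le_rfl) (by simp)
  -- If both intervals went inside, no parameter would be left for `γ (3 / 4)`; if neither did, none
  -- for `γ (1 / 4)`.
  rcases hl with hl | hl <;> rcases hr with hr | hr
  · obtain ⟨θ, hθ, h⟩ := hpt (3 / 4) (by norm_num)
    have hn : γ (3 / 4) ∉ γ '' Ioo 0 (1 / 2) := by
      rintro ⟨t, ht, h⟩
      have := hγi ⟨ht.1.le, by linarith [ht.2]⟩ (by norm_num) h
      linarith [ht.2]
    rw [← h] at hn
    rcases lt_trichotomy θ c with h' | rfl | h'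
    · exact (hn (hl θ ⟨hθ.1, h'⟩)).elim
    · have := hγi (by norm_num) (by norm_num) (hgc.symm.trans h)
      norm_num at this
    · exact (hn (hr θ ⟨h', hθ.2⟩)).elim
  · refine ⟨c, hc, Or.inl fun θ hθ => ⟨fun h => ?_, fun h => hl θ ⟨hθ.1, h⟩⟩⟩
    by_contra hlt
    rcases (not_lt.mp hlt).eq_or_lt with rfl | h'
    · exact hcn h
    · exact hr θ ⟨h', hθ.2⟩ h
  · refine ⟨c, hc, Or.inr fun θ hθ => ⟨fun h => ?_, fun h => hr θ ⟨h, hθ.2⟩⟩⟩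
    by_contra hlt
    rcases (not_lt.mp hlt).eq_or_lt with rfl | h'
    · exact hcn h
    · exact hl θ ⟨hθ.1, h'⟩ h
  · obtain ⟨θ, hθ, h⟩ := hpt (1 / 4) (by norm_num)
    have hn : γ (1 / 4) ∈ γ '' Ioo 0 (1 / 2) := ⟨1 / 4, by norm_num, rfl⟩
    rw [← h] at hn
    rcases lt_trichotomy θ c with h' | rfl | h'
    · exact (hl θ ⟨hθ.1, h'⟩ hn).elim
    · exact (hcn hn).elim
    · exact (hr θ ⟨h', hθ.2⟩ hn).elim

namespace SimpleGraph

namespace EndSpace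

section Circuits

variable {V : Type*} {G : SimpleGraph V}

theorem IsCircle.isTopCircle {C : Set G.EndSpace} (h : IsCircle C) : IsTopCircle C := by
  obtain ⟨f, hf, rfl⟩ := h
  exact isTopCircle_range hf

/-- One inner point brings in the whole open edge; the endvertices follow because circles are
closed. -/
theorem IsCircle.mem_edgesIn [T2Space G.EndSpace] {C : Set G.EndSpace} (h : IsCircle C)
    {e : G.edgeSet} {t : Ioo (0 : ℝ) 1} (ht : inner e t ∈ C) : e ∈ edgesIn C := by
  have h1 : Ioo (0 : ℝ) 1 ⊆ edgeCurve e ⁻¹' C := image_subset_iff.mp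
    (h.isTopCircle.image_Ioo_subset (isOpenArc_edgeCurve e) t.2
      (by rwa [edgeCurve_of_mem_Ioo e t.2]))
  have h2 := closure_minimal h1 (h.isTopCircle.isClosed.preimage (continuous_edgeCurve e))
  rw [closure_Ioo zero_ne_one] at h2
  intro s
  have := h2 s.2
  rwa [mem_preimage, edgeCurve_of_mem_Icc e s.2] at this

theorem vert_mem_of_mem_edgesIn {C : Set G.EndSpace} {e : G.edgeSet} (h : e ∈ edgesIn C) {v : V}
    (hv : v ∈ e.1) : vert v ∈ C := by
  obtain ⟨t, ht⟩ := vert_mem_range_edgePath.mpr hv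
  exact ht ▸ h t

theorem inner_mem_of_mem_edgesIn {C : Set G.EndSpace} {e : G.edgeSet} (h : e ∈ edgesIn C)
    (t : Ioo (0 : ℝ) 1) : inner e t ∈ C := by
  rw [← edgePath_of_mem e t.2]
  exact h _

/-- A circle is uncountable, while vertices and ends are countable in number. -/
theorem IsCircle.edgesIn_nonempty [T2Space G.EndSpace] [Countable V] [Countable G.end]
    {C : Set G.EndSpace} (h : IsCircle C) : (edgesIn C).Nonempty := by
  by_contra hne
  rw [not_nonempty_iff_eq_empty] at hne
  refine h.isTopCircle.not_countable
    (((countable_range (vert (G := G))).union (countable_range (atEnd (G := G)))).mono ?_)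
  intro z hz
  cases z with
  | vert v => exact Or.inl ⟨v, rfl⟩
  | atEnd ω => exact Or.inr ⟨ω, rfl⟩
  | inner e t => exact (hne ▸ h.mem_edgesIn hz : e ∈ (∅ : Set G.edgeSet)).elim

/-- The inequality defines an open neighbourhood of `v`; it consists of `v` and open half-edges at
`v`. -/
theorem eq_vert_or_mem_curveFrom {v : V} {z : G.EndSpace}
    (hz : 1 / 2 < linExt (fun w => open Classical in if w = v then (1 : ℝ) else 0) 0 z) :
    z = vert v ∨ ∃ e : G.edgeSet, v ∈ e.1 ∧ z ∈ curveFrom e v '' Ioo 0 (1 / 2) := by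
  classical
  cases z with
  | vert w =>
    simp only [linExt] at hz
    split_ifs at hz with h
    · exact Or.inl (h ▸ rfl)
    · norm_num at hz
  | atEnd ω => simp only [linExt] at hz; norm_num at hz
  | inner e t =>
    have hne := (adj_out e).ne
    obtain ⟨h0, h1⟩ := t.2
    simp only [linExt] at hz
    refine Or.inr ⟨e, ?_⟩
    by_cases h : (Quot.out e.1).1 = v
    · have h' : (Quot.out e.1).2 ≠ v := fun h'' => hne (h.trans h''.symm)
      rw [if_pos h, if_neg h'] at hz
      refine ⟨(mem_edge_iff e v).mpr (Or.inl h.symm), t, ⟨h0, by linarith⟩, ?_⟩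
      rw [curveFrom, if_pos h.symm]
      exact edgeCurve_of_mem_Ioo e t.2
    · rw [if_neg h] at hz
      by_cases h' : (Quot.out e.1).2 = v
      · rw [if_pos h'] at hz
        refine ⟨(mem_edge_iff e v).mpr (Or.inr h'.symm), 1 - t, ⟨by linarith, by linarith⟩, ?_⟩
        rw [curveFrom, if_neg (Ne.symm h), sub_sub_cancel]
        exact edgeCurve_of_mem_Ioo e t.2
      · rw [if_neg h'] at hz
        norm_num at hz

/-- Parametrise the circle from `v`. Each of its edges at `v` occupies, with its half near `v`, an
interval of parameters at the start or at the end. Parameters `a` near 0 and `b` near 1 lie in such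
intervals; every edge in `D` contains exactly one of `g a`, `g b`, and distinct half-edges are
disjoint. So there are exactly two edges. -/
theorem IsCircle.even_ncard_edgesIn [T2Space G.EndSpace] {C : Set G.EndSpace} (h : IsCircle C)
    {v : V} (hv : (G.neighborSet v).Finite) : Even (edgesIn C ∩ {e | v ∈ e.1}).ncard := by
  set D := edgesIn C ∩ {e : G.edgeSet | v ∈ e.1} with hD
  have hfin : D.Finite := (finite_setOf_mem_edge hv).subset inter_subset_right
  by_cases hvC : vert v ∈ C
  swap
  · have : D = ∅ := eq_empty_of_forall_notMem fun e he =>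
      hvC (vert_mem_of_mem_edgesIn he.1 he.2)
    simp [this]
  obtain ⟨g, hg, hi, h0, h1, rfl⟩ := h.isTopCircle.exists_param _ hvC
  let P : G.edgeSet → Set G.EndSpace := fun e => curveFrom e v '' Ioo 0 (1 / 2)
  have hP : ∀ e z, z ∈ P e → ∃ t, z = inner e t := by
    rintro e _ ⟨t, ht, rfl⟩
    exact curveFrom_mem_Ioo e v ⟨ht.1, by linarith [ht.2]⟩
  have hray : ∀ e ∈ D, ∃ c ∈ Ioo (0 : ℝ) 1, (∀ θ ∈ Ioo (0 : ℝ) 1, g θ ∈ P e ↔ θ < c) ∨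
      (∀ θ ∈ Ioo (0 : ℝ) 1, g θ ∈ P e ↔ c < θ) := by
    intro e he
    refine exists_ray_of_openArc hg hi (continuous_curveFrom e v) (injOn_curveFrom e v)
      (isOpenArc_curveFrom e v) ((curveFrom_zero he.2).trans h0.symm) ?_
    rintro _ ⟨t, ht, rfl⟩
    obtain ⟨t', ht'⟩ := curveFrom_mem_Ioo e v ht
    rw [ht']
    exact inner_mem_of_mem_edgesIn he.1 t'
  choose! c hc hLR using hray
  -- Close to a parameter of `v` the circle runs through half-edges at `v`, and it contains every
  -- edge of which it meets an inner point.
  have hstar : ∀ θ₀, g θ₀ = vert v → ∀ᶠ θ in 𝓝 θ₀, θ ∈ Ioo (0 : ℝ) 1 → ∃ e ∈ D, g θ ∈ P e := by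
    intro θ₀ hθ₀
    have hcont := (continuous_linExt_indicator (G := G) v).comp hg
    have : ∀ᶠ θ in 𝓝 θ₀, 1 / 2 <
        linExt (fun w => open Classical in if w = v then (1 : ℝ) else 0) 0 (g θ) :=
      hcont.continuousAt.eventually (lt_mem_nhds (by simp [hθ₀, linExt]; norm_num))
    filter_upwards [this] with θ hθ hθ'
    rcases eq_vert_or_mem_curveFrom hθ with hz | ⟨e, he, hz⟩
    · exact (hθ'.1.ne (hi ⟨le_rfl, one_pos⟩ ⟨hθ'.1.le, hθ'.2⟩ (h0.trans hz.symm))).elim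
    · refine ⟨e, ⟨?_, he⟩, hz⟩
      obtain ⟨t, ht⟩ := hP e _ hz
      exact h.mem_edgesIn (t := t) (ht ▸ ⟨θ, ⟨hθ'.1.le, hθ'.2⟩, rfl⟩)
  obtain ⟨a, ha, hac, ha'⟩ : ∃ a ∈ Ioo (0 : ℝ) 1, (∀ e ∈ D, a < c e) ∧ ∃ e ∈ D, g a ∈ P e := by
    have e1 : ∀ᶠ θ in 𝓝[>] (0 : ℝ), ∀ e ∈ D, θ < c e := (eventually_all_finite hfin).mpr
      fun e he => nhdsWithin_le_nhds (gt_mem_nhds (hc e he).1)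
    have e2 : ∀ᶠ θ in 𝓝[>] (0 : ℝ), θ ∈ Ioo (0 : ℝ) 1 := Ioo_mem_nhdsGT one_pos
    obtain ⟨θ, ⟨h1, h2⟩, h3⟩ := ((e1.and e2).and (nhdsWithin_le_nhds (hstar 0 h0))).exists
    exact ⟨θ, h2, h1, h3 h2⟩
  obtain ⟨b, hb, hbc, hb'⟩ : ∃ b ∈ Ioo (0 : ℝ) 1, (∀ e ∈ D, c e < b) ∧ ∃ e ∈ D, g b ∈ P e := by
    have e1 : ∀ᶠ θ in 𝓝[<] (1 : ℝ), ∀ e ∈ D, c e < θ := (eventually_all_finite hfin).mpr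
      fun e he => nhdsWithin_le_nhds (lt_mem_nhds (hc e he).2)
    have e2 : ∀ᶠ θ in 𝓝[<] (1 : ℝ), θ ∈ Ioo (0 : ℝ) 1 := Ioo_mem_nhdsLT one_pos
    obtain ⟨θ, ⟨h1, h2⟩, h3⟩ := ((e1.and e2).and (nhdsWithin_le_nhds (hstar 1 h1))).exists
    exact ⟨θ, h2, h1, h3 h2⟩
  have huniq : ∀ e e' z, z ∈ P e → z ∈ P e' → e = e' := by
    intro e e' z hz hz'
    obtain ⟨t, rfl⟩ := hP e z hz
    obtain ⟨t', ht'⟩ := hP e' _ hz'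
    exact (inner.inj ht').1
  have hor : ∀ e ∈ D, (g a ∈ P e ∧ g b ∉ P e) ∨ (g b ∈ P e ∧ g a ∉ P e) := by
    intro e he
    rcases hLR e he with hl | hr
    · exact Or.inl ⟨(hl a ha).mpr (hac e he), fun hx => (hbc e he).not_gt ((hl b hb).mp hx)⟩
    · exact Or.inr ⟨(hr b hb).mpr (hbc e he), fun hx => (hac e he).not_gt ((hr a ha).mp hx)⟩
  obtain ⟨e₁, he₁, h₁⟩ := ha'
  obtain ⟨e₂, he₂, h₂⟩ := hb'
  have hne : e₁ ≠ e₂ := by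
    rintro rfl
    rcases hor e₁ he₁ with h | h
    · exact h.2 h₂
    · exact h.2 h₁
  have hpair : D = {e₁, e₂} := by
    ext e
    constructor
    · intro he
      rcases hor e he with h | h
      · exact Or.inl (huniq _ _ _ h.1 h₁)
      · exact Or.inr (huniq _ _ _ h.1 h₂)
    · rintro (rfl | rfl) <;> assumption
  rw [hpair, ncard_pair hne]
  exact even_two

theorem IsArc.isCircle_union [T2Space G.EndSpace] {x y : G.EndSpace} {A B : Set G.EndSpace}
    (hA : IsArc x y A) (hB : IsArc x y B) (hxy : x ≠ y) (hAB : A ∩ B ⊆ {x, y}) :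
    IsCircle (A ∪ B) := by
  obtain ⟨f, a, b, hab, hc, hi, rfl, rfl, rfl⟩ := isArc_iff.mp hA
  obtain ⟨g, c, d, hcd, hc', hi', h1, h2, rfl⟩ := isArc_iff.mp hB.symm
  have hab' : a < b := hab.lt_of_ne (by rintro rfl; exact hxy rfl)
  have hd : b ≤ b + (d - c) := by linarith
  have hgm : ∀ t ∈ Icc b (b + (d - c)), t - b + c ∈ Icc c d := fun t ht =>
    ⟨by linarith [ht.1], by linarith [ht.2]⟩
  set k : ℝ → G.EndSpace := fun t => if t ≤ b then f t else g (t - b + c) with hk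
  have k1 : EqOn k f (Icc a b) := fun t ht => if_pos ht.2
  have k2 : EqOn k (fun t => g (t - b + c)) (Icc b (b + (d - c))) := by
    intro t ht
    rcases ht.1.eq_or_lt with rfl | h'
    · simp [hk, h1]
    · simp [hk, not_le.mpr h']
  have hU : Icc a (b + (d - c)) = Icc a b ∪ Icc b (b + (d - c)) :=
    (Icc_union_Icc_eq_Icc hab hd).symm
  have hkc : ContinuousOn k (Icc a (b + (d - c))) := by
    rw [hU]
    refine ContinuousOn.union_of_isClosed ?_ ?_ isClosed_Icc isClosed_Icc
    · exact hc.congr k1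
    · exact (hc'.comp (by fun_prop) hgm).congr k2
  have kend : k (b + (d - c)) = f a := by
    rw [k2 (right_mem_Icc.mpr hd), ← h2]
    exact congrArg g (by ring)
  have kst : k a = f a := k1 (left_mem_Icc.mpr hab)
  have key : ∀ t ∈ Icc a b, ∀ u ∈ Ioo b (b + (d - c)), k t ≠ k u := by
    intro t ht u hu htu
    have hu' := Ioo_subset_Icc_self hu
    rw [k1 ht, k2 hu'] at htu
    rcases hAB ⟨⟨t, ht, rfl⟩, ⟨_, hgm u hu', htu.symm⟩⟩ with h | h
    · have := hi' (hgm u hu') (right_mem_Icc.mpr hcd) ((htu.symm.trans h).trans h2.symm)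
      linarith [hu.2]
    · have := hi' (hgm u hu') (left_mem_Icc.mpr hcd) ((htu.symm.trans h).trans h1.symm)
      linarith [hu.1]
  have hki : InjOn k (Ico a (b + (d - c))) := by
    intro t ht u hu htu
    rcases le_or_gt t b with ht' | ht' <;> rcases le_or_gt u b with hu' | hu'
    · have ht1 : t ∈ Icc a b := ⟨ht.1, ht'⟩
      have hu1 : u ∈ Icc a b := ⟨hu.1, hu'⟩
      exact hi ht1 hu1 (by rw [← k1 ht1, ← k1 hu1, htu])
    · exact (key t ⟨ht.1, ht'⟩ u ⟨hu', hu.2⟩ htu).elim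
    · exact (key u ⟨hu.1, hu'⟩ t ⟨ht', ht.2⟩ htu.symm).elim
    · have ht1 : t ∈ Icc b (b + (d - c)) := ⟨ht'.le, ht.2.le⟩
      have hu1 : u ∈ Icc b (b + (d - c)) := ⟨hu'.le, hu.2.le⟩
      have := hi' (hgm t ht1) (hgm u hu1) (by simpa only [k2 ht1, k2 hu1] using htu)
      linarith
  have hlt : a < b + (d - c) := hab'.trans_le hd
  obtain ⟨q, hq, hq'⟩ := exists_isEmbedding_circle_of_Icc hlt hkc hki (kst.trans kend.symm)
  refine ⟨q, hq, ?_⟩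
  have h3 : k '' Ico a (b + (d - c)) = k '' Icc a (b + (d - c)) := by
    rw [← Ico_insert_right hlt.le, image_insert_eq, kend, insert_eq_of_mem]
    exact ⟨a, ⟨le_rfl, hlt⟩, kst⟩
  have h4 : (fun t => g (t - b + c)) '' Icc b (b + (d - c)) = g '' Icc c d := by
    ext z
    constructor
    · rintro ⟨t, ht, rfl⟩; exact ⟨_, hgm t ht, rfl⟩
    · rintro ⟨t, ht, rfl⟩
      exact ⟨t - c + b, ⟨by linarith [ht.1], by linarith [ht.2]⟩, congrArg g (by ring)⟩
  rw [hq', h3, hU, image_union, k1.image_eq, k2.image_eq, h4]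

theorem isArc_range_edgePath [T2Space G.EndSpace] {e : G.edgeSet} {v w : V} (h : e.1 = s(v, w)) :
    IsArc (vert v) (vert w) (range (edgePath e)) :=
  isArc_iff.mpr ⟨curveFrom e v, 0, 1, zero_le_one, (continuous_curveFrom e v).continuousOn,
    injOn_curveFrom e v, curveFrom_zero (h ▸ Sym2.mem_mk_left v w), curveFrom_one h,
    image_curveFrom_Icc e v⟩

end Circuits

end EndSpace

/-- By thinness only finitely many members meet the finite set `S`. Count incidences between `S` and
these members modulo 2 and exchange the two sums. -/
theorem even_ncard_inter_of_mem_thinSums {E : Type*} {N : Set (Set E)} {S : Set E}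
    (hS : S.Finite) (hN : ∀ F ∈ N, Even (F ∩ S).ncard) {D : Set E} (hD : D ∈ thinSums N) :
    Even (D ∩ S).ncard := by
  classical
  obtain ⟨ι, F, hF, hfin, rfl⟩ := hD
  have card : ∀ A : Set E, ((A ∩ S).ncard : ZMod 2) =
      ∑ e ∈ hS.toFinset, if e ∈ A then 1 else 0 := by
    intro A
    rw [Finset.sum_ite, Finset.sum_const_zero, add_zero, Finset.sum_const, nsmul_one]
    congr 1
    rw [ncard_eq_toFinset_card (A ∩ S) (hS.subset inter_subset_right)]
    congr 1
    ext e
    simp [and_comm]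
  let J : Finset ι := hS.toFinset.biUnion fun e => (hfin e).toFinset
  have hJ : ∀ e ∈ hS.toFinset, (if e ∈ {e | Odd {i | e ∈ F i}.ncard} then 1 else 0 : ZMod 2) =
      ∑ i ∈ J, if e ∈ F i then 1 else 0 := by
    intro e he
    have h1 : ((({i | e ∈ F i}.ncard : ℕ)) : ZMod 2) = ∑ i ∈ J, if e ∈ F i then 1 else 0 := by
      rw [Finset.sum_ite, Finset.sum_const_zero, add_zero, Finset.sum_const, nsmul_one]
      congr 1
      rw [ncard_eq_toFinset_card _ (hfin e)]
      congr 1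
      ext i
      simp only [Finite.mem_toFinset, mem_ofPred_eq, Finset.mem_filter, J, Finset.mem_biUnion]
      exact ⟨fun h => ⟨⟨e, by simpa using he, h⟩, h⟩, fun h => h.2⟩
    rw [← h1]
    split_ifs with h
    · exact ((ZMod.natCast_eq_one_iff_odd).mpr h).symm
    · exact ((ZMod.natCast_eq_zero_iff_even).mpr (Nat.not_odd_iff_even.mp h)).symm
  rw [← ZMod.natCast_eq_zero_iff_even, card]
  refine (Finset.sum_congr rfl fun e he => (by convert hJ e he)).trans ?_
  rw [Finset.sum_comm]
  refine Finset.sum_eq_zero fun i _ => ?_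
  rw [← card, ZMod.natCast_eq_zero_iff_even]
  exact hN _ (hF i)

end SimpleGraph

/-! ### Metric representations from compactness -/

theorem TopologicalSpace.eq_of_compactSpace_of_t2Space {X : Type*} {t₁ t₂ : TopologicalSpace X}
    (h₁ : @CompactSpace X t₁) (h₂ : @T2Space X t₂) (h : t₁ ≤ t₂) : t₁ = t₂ := by
  refine le_antisymm h ?_
  have hid : @Continuous X X t₁ t₂ id := continuous_id_iff_le.mpr h
  have hcl := @Continuous.isClosedMap X X t₁ t₂ h₁ h₂ id hid
  intro U hU
  have := hcl Uᶜ (@IsOpen.isClosed_compl X t₁ U hU)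
  rw [image_id] at this
  exact (@isClosed_compl_iff X t₂ U).mp this

/-- By compactness the injective function `φ` is a homeomorphism from `A` to the interval, and its
inverse parametrises `A`. This yields arcs ending at an end without a continuity check there. -/
theorem exists_isEmbedding_unitInterval_of_injOn {X : Type*} [TopologicalSpace X] {A : Set X}
    (hA : IsCompact A) {φ : X → ℝ} (hφ : Continuous φ) (hi : InjOn φ A) {a b : ℝ} (hab : a < b)
    (himg : φ '' A = Icc a b) :
    ∃ f : unitInterval → X, IsEmbedding f ∧ φ (f 0) = a ∧ φ (f 1) = b ∧ range f = A := by
  have : CompactSpace A := isCompact_iff_compactSpace.mp hA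
  have hc : Continuous (A.domRestrict φ) := hφ.comp continuous_subtype_val
  have hemb : IsEmbedding (A.domRestrict φ) :=
    (hc.isClosedEmbedding (injOn_iff_injective.mp hi)).isEmbedding
  have hr : range (A.domRestrict φ) = Icc a b := by rw [range_domRestrict, himg]
  let H : A ≃ₜ unitInterval :=
    (hemb.toHomeomorph.trans (Homeomorph.setCongr hr)).trans (iccHomeoI a b hab)
  have hH : ∀ z, φ (H.symm z) = (iccHomeoI a b hab).symm z := by
    intro z
    obtain ⟨w, rfl⟩ := H.surjective z
    rw [Homeomorph.symm_apply_apply]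
    simp only [H, Homeomorph.trans_apply, Homeomorph.symm_apply_apply]
    rfl
  refine ⟨fun z => (H.symm z : X), IsEmbedding.subtypeVal.comp H.symm.isEmbedding, ?_, ?_, ?_⟩
  · simp [hH]
  · simp [hH]
  · change range (Subtype.val ∘ H.symm) = A
    rw [H.symm.surjective.range_comp, Subtype.range_coe]

namespace SimpleGraph

open EndSpace

/-- Only one comparison of topologies is needed: sets open for the metric are open in |G|. On edges
this follows from `arcDist_edgePath_le`, at ends from `hend`. The converse holds because a
continuous bijection from a compact to a Hausdorff space is a homeomorphism. -/
theorem isMetricRepresentation_of_compactSpace {V : Type*} {G : SimpleGraph V} [Countable V]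
    [Subsingleton G.end] [CompactSpace G.EndSpace] (hG : ∀ v, (G.neighborSet v).Finite)
    {ℓ : G.edgeSet → ℝ} (hℓ : ∀ e, 0 < ℓ e) (hfin : ∀ x y, arcDist ℓ x y ≠ ⊤)
    (hend : ∀ ω, ∀ ε > 0, ∃ S, ContainsComponent {z | (arcDist ℓ z (atEnd ω)).toReal < ε} S ω) :
    G.IsMetricRepresentation ℓ := by
  have : T2Space G.EndSpace := t2Space_of_subsingleton_end hG
  refine ⟨hℓ, ?_⟩
  let m : MetricSpace G.EndSpace :=
    { dist := fun x y => (arcDist ℓ x y).toReal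
      dist_self := fun x => by rw [arcDist_self, ENNReal.toReal_zero]
      dist_comm := fun x y => by rw [arcDist_comm]
      dist_triangle := fun x y z => by
        rw [← ENNReal.toReal_add (hfin x y) (hfin y z)]
        exact ENNReal.toReal_mono (ENNReal.add_ne_top.mpr ⟨hfin x y, hfin y z⟩)
          (arcDist_triangle x y z)
      eq_of_dist_eq_zero := fun {x y} h => by
        by_contra hxy
        obtain ⟨K, φ, hφ, hne⟩ := exists_isEdgeLipschitz_ne hG hℓ hxy
        have h1 := hφ.ofReal_abs_sub_le hℓ x y
        rw [((ENNReal.toReal_eq_zero_iff _).mp h).resolve_right (hfin x y), mul_zero] at h1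
        have h2 : 0 < |φ x - φ y| := abs_pos.mpr (sub_ne_zero.mpr hne)
        exact absurd h1 (not_le.mpr (ENNReal.ofReal_pos.mpr h2)) }
  have hdist : ∀ x y, m.dist x y = (arcDist ℓ x y).toReal := fun _ _ => rfl
  refine ⟨m, fun x y => by rw [hdist, ENNReal.ofReal_toReal (hfin x y)], ?_⟩
  refine (TopologicalSpace.eq_of_compactSpace_of_t2Space ‹CompactSpace G.EndSpace›
    (by let := m; infer_instance) ?_).symm
  intro U hU
  have hU' := (@Metric.isOpen_iff _ m.toPseudoMetricSpace U).mp hU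
  refine ⟨fun e => Metric.isOpen_iff.mpr fun t ht => ?_, fun ω hω => ?_⟩
  · obtain ⟨ε, hε, hεU⟩ := hU' _ ht
    refine ⟨ε / ℓ e, div_pos hε (hℓ e), fun s hs => hεU ?_⟩
    have h1 := arcDist_edgePath_le hℓ e s t
    have h2 : ℓ e * |(s : ℝ) - t| < ε := by
      have : |(s : ℝ) - t| < ε / ℓ e := hs
      rwa [lt_div_iff₀' (hℓ e)] at this
    refine lt_of_le_of_lt ?_ h2
    exact ENNReal.toReal_le_of_le_ofReal (mul_nonneg (hℓ e).le (abs_nonneg _)) h1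
  · obtain ⟨ε, hε, hεU⟩ := hU' _ hω
    obtain ⟨S, hS⟩ := hend ω ε hε
    exact ⟨S, hS.mono hεU subset_rfl⟩

end SimpleGraph

/-! ### The ladder: one end, compactness -/

namespace SimpleGraph

open EndSpace

theorem EndSpace.out_eq_or_out_eq_swap {V : Type*} {G : SimpleGraph V} {e : G.edgeSet} {v w : V}
    (h : e.1 = s(v, w)) : ((Quot.out e.1).1 = v ∧ (Quot.out e.1).2 = w) ∨
      ((Quot.out e.1).1 = w ∧ (Quot.out e.1).2 = v) := by
  exact Sym2.eq_iff.mp ((mk_out e).trans h)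

theorem EndSpace.linExt_curveFrom {V : Type*} {G : SimpleGraph V} {e : G.edgeSet} {v w : V}
    (h : e.1 = s(v, w)) (f : V → ℝ) (c : ℝ) {t : ℝ} (ht : t ∈ Icc (0 : ℝ) 1) :
    linExt f c (curveFrom e v t) = (1 - t) * f v + t * f w := by
  have hne := (adj_out e).ne
  rcases out_eq_or_out_eq_swap h with ⟨h1, h2⟩ | ⟨h1, h2⟩
  · rw [curveFrom, if_pos h1.symm, edgeCurve_of_mem_Icc e ht, linExt_edgePath, h1, h2]
  · have hv : v ≠ (Quot.out e.1).1 := fun h' => hne (h'.symm.trans h2.symm)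
    have ht' : 1 - t ∈ Icc (0 : ℝ) 1 := ⟨by linarith [ht.2], by linarith [ht.1]⟩
    rw [curveFrom, if_neg hv, edgeCurve_of_mem_Icc e ht', linExt_edgePath, h1, h2]
    ring

/-- The one-way infinite ladder. Its two sides are the rays on the vertices `(k, false)` and on
the vertices `(k, true)`. -/
def ladder : SimpleGraph (ℕ × Bool) where
  Adj u v := (u.2 = v.2 ∧ (u.1 + 1 = v.1 ∨ v.1 + 1 = u.1)) ∨ (u.1 = v.1 ∧ u.2 ≠ v.2)
  symm := ⟨fun u v h => h.imp (fun h => ⟨h.1.symm, h.2.symm⟩) fun h => ⟨h.1.symm, h.2.symm⟩⟩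
  loopless := ⟨fun u h => by rcases h with ⟨-, h | h⟩ | ⟨-, h⟩ <;> first | omega | exact h rfl⟩

namespace ladder

/-- The edge of the ladder from `(k, b)` to `(k + 1, b)`. -/
def rail (k : ℕ) (b : Bool) : ladder.edgeSet :=
  ⟨s((k, b), (k + 1, b)), Or.inl ⟨rfl, Or.inl rfl⟩⟩

/-- The edge of the ladder from `(k, false)` to `(k, true)`. -/
def rung (k : ℕ) : ladder.edgeSet :=
  ⟨s((k, false), (k, true)), Or.inr ⟨rfl, by simp⟩⟩

theorem rail_val (k : ℕ) (b : Bool) : (rail k b).1 = s((k, b), (k + 1, b)) := rfl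

theorem rung_val (k : ℕ) : (rung k).1 = s((k, false), (k, true)) := rfl

theorem eq_rail_or_rung (e : ladder.edgeSet) : (∃ k b, e = rail k b) ∨ ∃ k, e = rung k := by
  obtain ⟨e, he⟩ := e
  induction e with
  | h u v =>
    obtain ⟨i, a⟩ := u
    obtain ⟨j, b⟩ := v
    rcases he with ⟨h, h' | h'⟩ | ⟨h, h'⟩
    · simp only at h h'
      subst h h'
      exact Or.inl ⟨i, a, rfl⟩
    · simp only at h h'
      subst h h'
      exact Or.inl ⟨j, a, Subtype.ext Sym2.eq_swap⟩
    · simp only at h h'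
      subst h
      refine Or.inr ⟨i, Subtype.ext ?_⟩
      cases a <;> cases b
      · exact (h' rfl).elim
      · rfl
      · exact Sym2.eq_swap
      · exact (h' rfl).elim

theorem mem_rail {v : ℕ × Bool} {k : ℕ} {b : Bool} :
    v ∈ (rail k b).1 ↔ v = (k, b) ∨ v = (k + 1, b) := Sym2.mem_iff

theorem mem_rung {v : ℕ × Bool} {k : ℕ} :
    v ∈ (rung k).1 ↔ v = (k, false) ∨ v = (k, true) := Sym2.mem_iff

theorem mk_mem_rung (k : ℕ) (b : Bool) : (k, b) ∈ (rung k).1 := by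
  rw [mem_rung]; cases b <;> simp

theorem rail_inj {k k' : ℕ} {b b' : Bool} : rail k b = rail k' b' ↔ k = k' ∧ b = b' := by
  constructor
  · intro h
    have h1 : (k, b) ∈ (rail k' b').1 := h ▸ mem_rail.mpr (Or.inl rfl)
    have h2 : (k + 1, b) ∈ (rail k' b').1 := h ▸ mem_rail.mpr (Or.inr rfl)
    simp only [mem_rail, Prod.mk.injEq] at h1 h2
    refine ⟨by omega, ?_⟩
    rcases h1 with h1 | h1 <;> exact h1.2
  · rintro ⟨rfl, rfl⟩; rfl

theorem rung_inj {k k' : ℕ} : rung k = rung k' ↔ k = k' := by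
  constructor
  · intro h
    have h1 : (k, false) ∈ (rung k').1 := h ▸ mem_rung.mpr (Or.inl rfl)
    simpa [mem_rung] using h1
  · rintro rfl; rfl

theorem rail_ne_rung {k k' : ℕ} {b : Bool} : rail k b ≠ rung k' := by
  intro h
  have h1 : (k, b) ∈ (rung k').1 := h ▸ mem_rail.mpr (Or.inl rfl)
  have h2 : (k + 1, b) ∈ (rung k').1 := h ▸ mem_rail.mpr (Or.inr rfl)
  simp only [mem_rung, Prod.mk.injEq] at h1 h2
  omega

theorem finite_fst_lt (n : ℕ) : {v : ℕ × Bool | v.1 < n}.Finite :=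
  ((finite_Iio n).prod (finite_univ (α := Bool))).subset fun _ hv => ⟨hv, mem_univ _⟩

theorem finite_neighborSet (v : ℕ × Bool) : (ladder.neighborSet v).Finite := by
  refine (finite_fst_lt (v.1 + 2)).subset fun w hw => ?_
  change w.1 < v.1 + 2
  rcases hw with ⟨-, h | h⟩ | ⟨h, -⟩ <;> omega

theorem connected : ladder.Connected := by
  have h1 : ∀ k b, ladder.Reachable (0, false) (k, b) := by
    intro k b
    induction k with
    | zero =>
      cases b
      · rfl
      · exact Adj.reachable (G := ladder) (rung 0).2
    | succ k ih => exact ih.trans (Adj.reachable (G := ladder) (rail k b).2)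
  exact (connected_iff_exists_forall_reachable _).mpr ⟨(0, false), fun ⟨k, b⟩ => h1 k b⟩

/-- The vertices of height less than `n`. -/
noncomputable def bottom (n : ℕ) : Finset (ℕ × Bool) := (finite_fst_lt n).toFinset

theorem mem_bottom {n : ℕ} {v : ℕ × Bool} : v ∈ bottom n ↔ v.1 < n := by
  simp [bottom]

theorem notMem_bottom {n : ℕ} {v : ℕ × Bool} : v ∉ (bottom n : Set (ℕ × Bool)) ↔ n ≤ v.1 := by
  rw [Finset.mem_coe, mem_bottom, not_lt]

theorem exists_subset_bottom (S : Finset (ℕ × Bool)) : ∃ n, S ⊆ bottom n := by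
  obtain ⟨n, hn⟩ := (S.image Prod.fst).exists_nat_subset_range
  refine ⟨n, fun v hv => mem_bottom.mpr ?_⟩
  exact Finset.mem_range.mp (hn (Finset.mem_image_of_mem _ hv))

/-- Every remaining vertex descends along its side to height `n`, where the `n`-th rung joins the
two sides. -/
theorem componentComplMk_bottom (n : ℕ) {v w : ℕ × Bool} (hv : v ∉ (bottom n : Set (ℕ × Bool)))
    (hw : w ∉ (bottom n : Set (ℕ × Bool))) :
    ladder.componentComplMk hv = ladder.componentComplMk hw := by
  have h0 : ∀ b, (n, b) ∉ (bottom n : Set (ℕ × Bool)) := fun b => notMem_bottom.mpr le_rfl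
  have h1 : ∀ b d (h : (n + d, b) ∉ (bottom n : Set (ℕ × Bool))),
      ladder.componentComplMk h = ladder.componentComplMk (h0 false) := by
    intro b d
    induction d with
    | zero =>
      intro h
      cases b
      · rfl
      · exact componentComplMk_eq_of_adj _ _ _ (Adj.symm (G := ladder) (rung n).2)
    | succ d ih =>
      intro h
      have h' : (n + d, b) ∉ (bottom n : Set (ℕ × Bool)) := notMem_bottom.mpr (Nat.le_add_right _ _)
      rw [← ih h']
      exact componentComplMk_eq_of_adj _ _ _ (Adj.symm (G := ladder) (rail (n + d) b).2)
  have h2 : ∀ v (hv : v ∉ (bottom n : Set (ℕ × Bool))),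
      ladder.componentComplMk hv = ladder.componentComplMk (h0 false) := by
    rintro ⟨k, b⟩ hv
    obtain ⟨d, rfl⟩ := Nat.exists_eq_add_of_le (notMem_bottom.mp hv)
    exact h1 b d hv
  rw [h2 v, h2 w]

theorem mem_endComponent_bottom {n : ℕ} {ω : ladder.end} {v : ℕ × Bool} :
    v ∈ ladder.endComponent (bottom n) ω ↔ n ≤ v.1 := by
  refine ⟨fun h => notMem_bottom.mp (ComponentCompl.notMem_of_mem h), fun h => ?_⟩
  obtain ⟨w, hw, hw'⟩ := (ladder.endComponent (bottom n) ω).exists_eq_mk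
  exact ⟨notMem_bottom.mpr h, (componentComplMk_bottom n _ hw).trans hw'⟩

theorem containsComponent_bottom {U : Set ladder.EndSpace} {n : ℕ} {ω : ladder.end}
    (h1 : ∀ v : ℕ × Bool, n ≤ v.1 → vert v ∈ U)
    (h2 : ∀ (e : ladder.edgeSet) t, (∀ v ∈ e.1, n ≤ v.1) → inner e t ∈ U)
    (h3 : ∀ ω, atEnd ω ∈ U) : ContainsComponent U (bottom n) ω :=
  ⟨fun v hv => h1 v (mem_endComponent_bottom.mp hv),
    fun e t he => h2 e t fun v hv => mem_endComponent_bottom.mp (he v hv), fun ω' _ => h3 ω'⟩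

/-- The sets `bottom n` are cofinal among the finite vertex sets, and each leaves just one
component. -/
instance : Subsingleton ladder.end := by
  refine ⟨fun ω ω' => Subtype.ext (funext fun S => ?_)⟩
  obtain ⟨n, hn⟩ := exists_subset_bottom S.unop
  have hn' : (S.unop : Set (ℕ × Bool)) ⊆ bottom n := Finset.coe_subset.mpr hn
  have h : ladder.endComponent (bottom n) ω = ladder.endComponent (bottom n) ω' := by
    refine SetLike.ext fun v => ?_
    rw [mem_endComponent_bottom, mem_endComponent_bottom]
  have h1 := ladder.endComponent_hom hn' ω
  rw [h, ladder.endComponent_hom hn' ω'] at h1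
  exact h1.symm

theorem end_nonempty : ladder.end.Nonempty := by
  have : LocallyFinite ladder := fun v => (finite_neighborSet v).fintype
  have : Fact ladder.Preconnected := ⟨connected.preconnected⟩
  exact nonempty_ends_of_infinite ladder

theorem isOneEnded : ladder.IsOneEnded := by
  obtain ⟨ω, hω⟩ := end_nonempty
  refine ncard_eq_one.mpr ⟨ω, subset_antisymm (fun ω' hω' => ?_) (singleton_subset_iff.mpr hω)⟩
  exact congrArg Subtype.val (Subsingleton.elim (⟨ω', hω'⟩ : ladder.end) ⟨ω, hω⟩)

instance : T2Space ladder.EndSpace := t2Space_of_subsingleton_end finite_neighborSet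

/-- Outside a neighbourhood of the end, everything lies on the finitely many closed edges with an
endvertex in some `bottom n`. -/
theorem isCompact_compl {U : Set ladder.EndSpace} (hU : IsOpen U) {ω : ladder.end}
    (hω : atEnd ω ∈ U) : IsCompact Uᶜ := by
  obtain ⟨S, hS⟩ := hU.2 ω hω
  obtain ⟨n, hn⟩ := exists_subset_bottom S
  have hC := hS.mono subset_rfl hn
  have hE : (⋃ v ∈ bottom n, {e : ladder.edgeSet | v ∈ e.1}).Finite :=
    (bottom n).finite_toSet.biUnion fun v _ => finite_setOf_mem_edge (finite_neighborSet v)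
  have hK : IsCompact (⋃ e ∈ ⋃ v ∈ bottom n, {e : ladder.edgeSet | v ∈ e.1}, range (edgePath e)) :=
    hE.isCompact_biUnion fun e _ => isCompact_range (continuous_edgePath e)
  refine hK.of_isClosed_subset hU.isClosed_compl fun z hz => ?_
  have hmem : ∀ (v : ℕ × Bool) (e : ladder.edgeSet), v ∈ e.1 → v.1 < n → z ∈ range (edgePath e) →
      z ∈ ⋃ e ∈ ⋃ v ∈ bottom n, {e : ladder.edgeSet | v ∈ e.1}, range (edgePath e) := by
    intro v e hv hvn hz
    exact mem_biUnion (mem_biUnion (mem_bottom.mpr hvn) hv) hz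
  cases z with
  | vert v =>
    have hv : v.1 < n := by
      by_contra h
      exact hz (hC.1 v (mem_endComponent_bottom.mpr (not_lt.mp h)))
    exact hmem v (rung v.1) (mk_mem_rung v.1 v.2) hv
      (vert_mem_range_edgePath.mpr (mk_mem_rung v.1 v.2))
  | inner e t =>
    have he : ∃ v ∈ e.1, v.1 < n := by
      by_contra h
      push Not at h
      exact hz (hC.2.1 e t fun v hv => mem_endComponent_bottom.mpr (h v hv))
    obtain ⟨v, hv, hvn⟩ := he
    exact hmem v e hv hvn (inner_mem_range_edgePath.mpr rfl)
  | atEnd ω' => exact (hz (Subsingleton.elim ω ω' ▸ hω)).elim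

/-- An ultrafilter that does not converge to the end contains the complement of an open
neighbourhood of the end, which is compact. -/
instance : CompactSpace ladder.EndSpace := by
  obtain ⟨ω, hω⟩ := end_nonempty
  refine ⟨isCompact_iff_ultrafilter_le_nhds.mpr fun F _ => ?_⟩
  by_cases h : ∀ U, IsOpen U → atEnd ⟨ω, hω⟩ ∈ U → U ∈ F
  · refine ⟨atEnd ⟨ω, hω⟩, mem_univ _, fun U hU => ?_⟩
    obtain ⟨O, hOU, hO, hωO⟩ := mem_nhds_iff.mp hU
    exact mem_of_superset (h O hO hωO) hOU
  · push Not at h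
    obtain ⟨U, hU, hωU, hUF⟩ := h
    obtain ⟨x, -, hx⟩ := isCompact_iff_ultrafilter_le_nhds.mp (isCompact_compl hU hωU) F
      (le_principal_iff.mpr (Ultrafilter.compl_mem_iff_notMem.mpr hUF))
    exact ⟨x, mem_univ _, hx⟩

end ladder

end SimpleGraph

/-! ### Edge lengths and distances in the ladder -/

namespace SimpleGraph

open EndSpace

namespace ladder

/-- The signed position of a vertex, whose square differences are the edge lengths. -/
noncomputable def pos (v : ℕ × Bool) : ℝ := (if v.2 then 1 else -1) * (1 / 2) ^ v.1

/-- The edge lengths: the `k`-th edges of the sides have length `4⁻ᵏ / 4`, and the `k`-th rung has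
length `4 * 4⁻ᵏ`. -/
noncomputable def len (e : ladder.edgeSet) : ℝ :=
  (pos (Quot.out e.1).1 - pos (Quot.out e.1).2) ^ 2

/-- Squaring makes the length independent of the orientation that `Quot.out` selects. -/
theorem len_eq {e : ladder.edgeSet} {v w : ℕ × Bool} (h : e.1 = s(v, w)) :
    len e = (pos v - pos w) ^ 2 := by
  rcases out_eq_or_out_eq_swap h with ⟨h1, h2⟩ | ⟨h1, h2⟩ <;> rw [len, h1, h2]
  ring

theorem len_rail (k : ℕ) (b : Bool) : len (rail k b) = (1 / 4) ^ k / 4 := by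
  have h4 : ((1 : ℝ) / 4) ^ k = ((1 / 2) ^ k) ^ 2 := by rw [← pow_mul, mul_comm, pow_mul]; norm_num
  rw [len_eq (rail_val k b), h4]
  cases b <;> simp [pos, pow_succ] <;> ring

theorem len_rung (k : ℕ) : len (rung k) = 4 * (1 / 4) ^ k := by
  have h4 : ((1 : ℝ) / 4) ^ k = ((1 / 2) ^ k) ^ 2 := by rw [← pow_mul, mul_comm, pow_mul]; norm_num
  rw [len_eq (rung_val k), h4]
  simp [pos]
  ring

theorem len_pos (e : ladder.edgeSet) : 0 < len e := by
  rcases eq_rail_or_rung e with ⟨k, b, rfl⟩ | ⟨k, rfl⟩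
  · rw [len_rail]; positivity
  · rw [len_rung]; positivity

/-- The total length `4⁻ᵏ / 3` of either side from height `k` on. -/
noncomputable def tailLen (k : ℕ) : ℝ := (1 / 4) ^ k / 3

theorem tailLen_pos (k : ℕ) : 0 < tailLen k := by unfold tailLen; positivity

theorem tailLen_succ (k : ℕ) : tailLen (k + 1) = tailLen k / 4 := by
  simp only [tailLen, pow_succ]; ring

theorem tailLen_anti : StrictAnti tailLen :=
  strictAnti_nat_of_succ_lt fun k => by rw [tailLen_succ]; linarith [tailLen_pos k]

theorem exists_tailLen_lt {ε : ℝ} (hε : 0 < ε) : ∃ n, tailLen n < ε := by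
  obtain ⟨n, hn⟩ := exists_pow_lt_of_lt_one hε (by norm_num : (1 / 4 : ℝ) < 1)
  refine ⟨n, lt_of_le_of_lt ?_ hn⟩
  have : (0 : ℝ) < (1 / 4) ^ n := by positivity
  unfold tailLen
  linarith

theorem continuous_linExt_of_abs_le {h : ℕ × Bool → ℝ} (hh : ∀ v, |h v| ≤ tailLen v.1) :
    Continuous (linExt (G := ladder) h 0) := by
  refine continuous_linExt fun ε hε => ?_
  obtain ⟨n, hn⟩ := exists_tailLen_lt hε
  refine (finite_fst_lt n).subset fun v hv => ?_
  by_contra hvn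
  have h1 := tailLen_anti.antitone (not_lt.mp hvn)
  have h2 : ε ≤ |h v - 0| := hv
  rw [sub_zero] at h2
  linarith [hh v]

/-- The points of the side `b`, parametrised edge by edge. -/
noncomputable def sidePt (b : Bool) (j : ℕ) (s : ℝ) : ladder.EndSpace :=
  curveFrom (rail j b) (j, b) s

/-- The function on `|G|` that vanishes precisely on the side `b` and at the end. -/
noncomputable def offSide (b : Bool) : ladder.EndSpace → ℝ :=
  linExt (fun v => if v.2 = b then 0 else tailLen v.1) 0

/-- The function on `|G|` that measures on either side the distance from the end. -/
noncomputable def height : ladder.EndSpace → ℝ := linExt (fun v => tailLen v.1) 0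

theorem continuous_height : Continuous height :=
  continuous_linExt_of_abs_le fun v => (abs_of_pos (tailLen_pos v.1)).le

theorem continuous_offSide (b : Bool) : Continuous (offSide b) := by
  refine continuous_linExt_of_abs_le fun v => ?_
  have := tailLen_pos v.1
  split_ifs
  · simpa using this.le
  · exact (abs_of_pos this).le

theorem height_sidePt (b : Bool) (j : ℕ) {s : ℝ} (hs : s ∈ Icc (0 : ℝ) 1) :
    height (sidePt b j s) = (1 - s) * tailLen j + s * tailLen (j + 1) :=
  linExt_curveFrom (rail_val j b) _ _ hs

theorem offSide_sidePt (b : Bool) (j : ℕ) {s : ℝ} (hs : s ∈ Icc (0 : ℝ) 1) :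
    offSide b (sidePt b j s) = 0 := by
  rw [offSide, sidePt, linExt_curveFrom (rail_val j b) _ _ hs]
  simp

theorem height_sidePt_mem (b : Bool) (j : ℕ) {s : ℝ} (hs : s ∈ Ico (0 : ℝ) 1) :
    height (sidePt b j s) ∈ Ioc (tailLen (j + 1)) (tailLen j) := by
  rw [height_sidePt b j ⟨hs.1, hs.2.le⟩, tailLen_succ]
  have := tailLen_pos j
  obtain ⟨h0, h1⟩ := hs
  constructor <;> nlinarith

theorem eq_of_height_sidePt_eq (b : Bool) {j j' : ℕ} {s s' : ℝ} (hs : s ∈ Ico (0 : ℝ) 1)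
    (hs' : s' ∈ Ico (0 : ℝ) 1) (h : height (sidePt b j s) = height (sidePt b j' s')) :
    j = j' ∧ s = s' := by
  have h1 := height_sidePt_mem b j hs
  have h2 := height_sidePt_mem b j' hs'
  have hj : j = j' := by
    rw [← h] at h2
    have k1 := tailLen_anti.lt_iff_gt.mp (h1.1.trans_le h2.2)
    have k2 := tailLen_anti.lt_iff_gt.mp (h2.1.trans_le h1.2)
    omega
  subst hj
  refine ⟨rfl, ?_⟩
  rw [height_sidePt b j ⟨hs.1, hs.2.le⟩, height_sidePt b j ⟨hs'.1, hs'.2.le⟩, tailLen_succ] at h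
  have := tailLen_pos j
  have h3 : (s - s') * tailLen j = 0 := by linarith
  rcases mul_eq_zero.mp h3 with h3 | h3 <;> linarith

/-- The vertex values are nonnegative and the function is affine on edges, so a zero at an inner
point forces zeros at both endvertices; the edge then cannot be a rung. -/
theorem eq_sidePt_of_offSide_eq_zero {b : Bool} {z : ladder.EndSpace} (hz : offSide b z = 0) :
    (∃ ω, z = atEnd ω) ∨ ∃ j, ∃ s ∈ Ico (0 : ℝ) 1, z = sidePt b j s := by
  cases z with
  | atEnd ω => exact Or.inl ⟨ω, rfl⟩
  | vert v =>
    obtain ⟨j, a⟩ := v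
    have ha : a = b := by
      by_contra h
      simp only [offSide, linExt, h, if_false] at hz
      exact (tailLen_pos j).ne' hz
    subst ha
    exact Or.inr ⟨j, 0, ⟨le_rfl, one_pos⟩, (curveFrom_zero (mem_rail.mpr (Or.inl rfl))).symm⟩
  | inner e t =>
    refine Or.inr ?_
    obtain ⟨h0, h1⟩ := t.2
    have hv : ∀ v ∈ e.1, v.2 = b := by
      set f : ℕ × Bool → ℝ := fun v => if v.2 = b then 0 else tailLen v.1 with hf
      have hnn : ∀ v, 0 ≤ f v := by
        intro v
        simp only [hf]
        split_ifs
        exacts [le_rfl, (tailLen_pos _).le]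
      have hz' : (1 - (t : ℝ)) * f (Quot.out e.1).1 + t * f (Quot.out e.1).2 = 0 := hz
      have hf0 : ∀ v, f v = 0 → v.2 = b := by
        intro v hv
        by_contra h
        simp only [hf, h, if_false] at hv
        exact (tailLen_pos _).ne' hv
      have k1 := mul_nonneg (sub_pos.mpr h1).le (hnn (Quot.out e.1).1)
      have k2 := mul_nonneg h0.le (hnn (Quot.out e.1).2)
      intro v hv
      rcases (mem_edge_iff e v).mp hv with rfl | rfl
      · exact hf0 _ ((mul_eq_zero.mp (by linarith :
          (1 - (t : ℝ)) * f (Quot.out e.1).1 = 0)).resolve_left (sub_pos.mpr h1).ne')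
      · exact hf0 _ ((mul_eq_zero.mp (by linarith :
          (t : ℝ) * f (Quot.out e.1).2 = 0)).resolve_left h0.ne')
    rcases eq_rail_or_rung e with ⟨k, a, rfl⟩ | ⟨k, rfl⟩
    · obtain rfl : a = b := hv (k, a) (mem_rail.mpr (Or.inl rfl))
      obtain ⟨s, hs, hs'⟩ := exists_curveFrom_eq_inner (rail k a) (k, a) t
      exact ⟨k, s, Ioo_subset_Ico_self hs, hs'.symm⟩
    · have h1 := hv _ (mk_mem_rung k true)
      have h2 := hv _ (mk_mem_rung k false)
      exact absurd (h1.trans h2.symm) (by simp)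

theorem exists_height_sidePt_eq (b : Bool) {k : ℕ} {y : ℝ} (hy : 0 < y) (hyk : y ≤ tailLen k) :
    ∃ j, ∃ s ∈ Ico (0 : ℝ) 1, height (sidePt b j s) = y := by
  have hk : y ≤ tailLen 0 := hyk.trans (tailLen_anti.antitone (Nat.zero_le k))
  have h1 : 3 * y ≤ 1 := by
    simp only [tailLen, pow_zero] at hk
    linarith
  -- Since `tailLen j` is a third of `(1 / 4) ^ j`, locating `3 * y` between powers of 1 / 4 locates
  -- `y` between tail lengths.
  obtain ⟨j, hj, hj'⟩ := exists_nat_pow_near_of_lt_one (by linarith : 0 < 3 * y) h1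
    (by norm_num : (0 : ℝ) < 1 / 4) (by norm_num)
  have h2 : tailLen (j + 1) < y := by unfold tailLen; linarith
  have h3 : y ≤ tailLen j := by unfold tailLen; linarith
  have hpos := tailLen_pos j
  rw [tailLen_succ] at h2
  -- The solution `s` of the linear equation `(1 - s) * tailLen j + s * (tailLen j / 4) = y`.
  have hs : (tailLen j - y) / (tailLen j * (3 / 4)) ∈ Ico (0 : ℝ) 1 :=
    ⟨div_nonneg (by linarith) (by linarith), (div_lt_one (by linarith)).mpr (by linarith)⟩
  refine ⟨j, _, hs, ?_⟩
  rw [height_sidePt b j ⟨hs.1, hs.2.le⟩, tailLen_succ]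
  field_simp
  ring

/-- The part of the side `b` from height `k` on, with the end. -/
def sideArc (b : Bool) (k : ℕ) : Set ladder.EndSpace :=
  {z | offSide b z = 0 ∧ height z ≤ tailLen k}

theorem isClosed_sideArc (b : Bool) (k : ℕ) : IsClosed (sideArc b k) :=
  (isClosed_eq (continuous_offSide b) continuous_const).inter
    (isClosed_le continuous_height continuous_const)

theorem injOn_height (b : Bool) (k : ℕ) : InjOn height (sideArc b k) := by
  intro z hz w hw h
  rcases eq_sidePt_of_offSide_eq_zero hz.1 with ⟨ω, rfl⟩ | ⟨j, s, hs, rfl⟩ <;>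
    rcases eq_sidePt_of_offSide_eq_zero hw.1 with ⟨ω', rfl⟩ | ⟨j', s', hs', rfl⟩
  · rw [Subsingleton.elim ω ω']
  · have := (height_sidePt_mem b j' hs').1
    rw [← h] at this
    exact absurd this (not_lt.mpr (tailLen_pos _).le)
  · have := (height_sidePt_mem b j hs).1
    rw [h] at this
    exact absurd this (not_lt.mpr (tailLen_pos _).le)
  · obtain ⟨rfl, rfl⟩ := eq_of_height_sidePt_eq b hs hs' h
    rfl

theorem height_image_sideArc (b : Bool) (k : ℕ) :
    height '' sideArc b k = Icc 0 (tailLen k) := by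
  apply subset_antisymm
  · rintro _ ⟨z, hz, rfl⟩
    refine ⟨?_, hz.2⟩
    rcases eq_sidePt_of_offSide_eq_zero hz.1 with ⟨ω, rfl⟩ | ⟨j, s, hs, rfl⟩
    · exact le_rfl
    · exact (tailLen_pos _).le.trans (height_sidePt_mem b j hs).1.le
  · rintro y ⟨hy, hyk⟩
    rcases hy.eq_or_lt with rfl | hy
    · obtain ⟨ω, hω⟩ := end_nonempty
      exact ⟨atEnd ⟨ω, hω⟩, ⟨rfl, (tailLen_pos k).le⟩, rfl⟩
    · obtain ⟨j, s, hs, rfl⟩ := exists_height_sidePt_eq b hy hyk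
      exact ⟨_, ⟨offSide_sidePt b j ⟨hs.1, hs.2.le⟩, hyk⟩, rfl⟩

/-- `height` maps this compact set bijectively onto `Icc 0 (tailLen k)`, with the end at 0. -/
theorem isArc_sideArc (b : Bool) (k : ℕ) (ω : ladder.end) :
    IsArc (atEnd ω) (vert (k, b)) (sideArc b k) := by
  obtain ⟨f, hf, h0, h1, hr⟩ := exists_isEmbedding_unitInterval_of_injOn
    (isClosed_sideArc b k).isCompact continuous_height (injOn_height b k) (tailLen_pos k)
    (height_image_sideArc b k)
  refine Or.inr ⟨f, hf, ?_, ?_, hr⟩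
  · exact injOn_height b k (hr ▸ mem_range_self _) ⟨rfl, (tailLen_pos k).le⟩ h0
  · exact injOn_height b k (hr ▸ mem_range_self _) ⟨by simp [offSide, linExt], le_rfl⟩ h1

/-- Only the rails of this side from height `k` on meet the set in inner points. Counting each in
full gives a geometric series with sum `tailLen k`. -/
theorem length_sideArc_le (b : Bool) (k : ℕ) :
    EndSpace.length len (sideArc b k) ≤ ENNReal.ofReal (tailLen k) := by
  have hinj : Function.Injective fun i => rail (k + i) b := fun i j hij => by
    have := (rail_inj.mp hij).1
    omega
  set F : ladder.edgeSet → ℝ≥0∞ := fun e => ENNReal.ofReal (len e) *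
    MeasureTheory.volume {t : ℝ | ∃ ht : t ∈ Ioo (0 : ℝ) 1,
      EndSpace.inner e ⟨t, ht⟩ ∈ sideArc b k} with hF
  have hsupp : Function.support F ⊆ range fun i => rail (k + i) b := by
    intro e he
    by_contra hne
    refine he ?_
    have : {t : ℝ | ∃ ht : t ∈ Ioo (0 : ℝ) 1, EndSpace.inner e ⟨t, ht⟩ ∈ sideArc b k} = ∅ := by
      refine eq_empty_of_forall_notMem ?_
      rintro t ⟨ht, hz⟩
      rcases eq_sidePt_of_offSide_eq_zero hz.1 with ⟨ω, h⟩ | ⟨j, s, hs, h⟩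
      · simp at h
      · have hmem : EndSpace.inner e ⟨t, ht⟩ ∈ range (edgePath (rail j b)) := by
          rw [h, ← image_curveFrom_Icc (rail j b) (j, b)]
          exact ⟨s, ⟨hs.1, hs.2.le⟩, rfl⟩
        have hz2 := hz.2
        rw [h] at hz2
        have hlt := tailLen_anti.lt_iff_gt.mp ((height_sidePt_mem b j hs).1.trans_le hz2)
        obtain ⟨i, rfl⟩ := Nat.exists_eq_add_of_le (Nat.lt_succ_iff.mp hlt)
        exact hne ⟨i, (inner_mem_range_edgePath.mp hmem).symm⟩
    rw [hF]
    simp only [this, MeasureTheory.measure_empty, mul_zero]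
  have hle : ∀ i, F (rail (k + i) b) ≤ ENNReal.ofReal ((1 / 4) ^ k / 4 * (1 / 4) ^ i) := by
    intro i
    have hvol : MeasureTheory.volume {t : ℝ | ∃ ht : t ∈ Ioo (0 : ℝ) 1,
        EndSpace.inner (rail (k + i) b) ⟨t, ht⟩ ∈ sideArc b k} ≤ 1 := by
      refine (MeasureTheory.measure_mono fun t ht => ht.1).trans_eq ?_
      rw [Real.volume_Ioo]
      simp
    refine (mul_le_mul_right hvol _).trans_eq ?_
    rw [mul_one, len_rail, pow_add]
    congr 1
    ring
  have hgeo := (hasSum_geometric_of_lt_one (by norm_num : (0 : ℝ) ≤ 1 / 4) (by norm_num)).mul_left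
    ((1 / 4 : ℝ) ^ k / 4)
  calc EndSpace.length len (sideArc b k) = ∑' i, F (rail (k + i) b) := (hinj.tsum_eq hsupp).symm
    _ ≤ ∑' i, ENNReal.ofReal ((1 / 4) ^ k / 4 * (1 / 4) ^ i) := ENNReal.tsum_le_tsum hle
    _ = ENNReal.ofReal (tailLen k) := by
        rw [← ENNReal.ofReal_tsum_of_nonneg (fun i => by positivity) hgeo.summable, hgeo.tsum_eq]
        congr 1
        unfold tailLen
        ring

theorem arcDist_vert_atEnd_le (v : ℕ × Bool) (ω : ladder.end) :
    arcDist len (vert v) (atEnd ω) ≤ ENNReal.ofReal (tailLen v.1) :=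
  (isArc_sideArc v.2 v.1 ω).symm.arcDist_le.trans (length_sideArc_le v.2 v.1)

theorem arcDist_inner_atEnd_le (e : ladder.edgeSet) (t : Ioo (0 : ℝ) 1) (ω : ladder.end) :
    arcDist len (inner e t) (atEnd ω) ≤
      ENNReal.ofReal (len e + tailLen (Quot.out e.1).1.1) := by
  rw [ENNReal.ofReal_add (len_pos e).le (tailLen_pos _).le]
  refine (arcDist_triangle _ (vert (Quot.out e.1).1) _).trans
    (add_le_add ?_ (arcDist_vert_atEnd_le _ ω))
  rw [← edgePath_of_mem e t.2, ← edgePath_zero]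
  refine (arcDist_edgePath_le len_pos e _ _).trans (ENNReal.ofReal_le_ofReal ?_)
  refine mul_le_of_le_one_right (len_pos e).le ?_
  have h0 := t.2.1
  have h1 := t.2.2
  rw [abs_le]
  constructor <;> simp <;> linarith

theorem arcDist_atEnd_ne_top (x : ladder.EndSpace) (ω : ladder.end) :
    arcDist len x (atEnd ω) ≠ ⊤ := by
  cases x with
  | vert v => exact ne_top_of_le_ne_top ENNReal.ofReal_ne_top (arcDist_vert_atEnd_le v ω)
  | inner e t => exact ne_top_of_le_ne_top ENNReal.ofReal_ne_top (arcDist_inner_atEnd_le e t ω)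
  | atEnd ω' => rw [Subsingleton.elim ω' ω, arcDist_self]; exact ENNReal.zero_ne_top

theorem arcDist_ne_top (x y : ladder.EndSpace) : arcDist len x y ≠ ⊤ := by
  obtain ⟨ω, hω⟩ := end_nonempty
  refine ne_top_of_le_ne_top (ENNReal.add_ne_top.mpr ⟨arcDist_atEnd_ne_top x ⟨ω, hω⟩, ?_⟩)
    (arcDist_triangle x (atEnd ⟨ω, hω⟩) y)
  rw [arcDist_comm]
  exact arcDist_atEnd_ne_top y ⟨ω, hω⟩

/-- The constant is due to the rungs; a rail has length only 3 / 4 of the tail length at its lower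
end. -/
theorem len_le {e : ladder.edgeSet} {n : ℕ} (he : ∀ v ∈ e.1, n ≤ v.1) :
    len e ≤ 12 * tailLen n := by
  rcases eq_rail_or_rung e with ⟨k, b, rfl⟩ | ⟨k, rfl⟩
  · have := tailLen_anti.antitone (he (k, b) (mem_rail.mpr (Or.inl rfl)))
    have hk := tailLen_pos n
    rw [len_rail]
    simp only [tailLen] at this hk ⊢
    linarith
  · have := tailLen_anti.antitone (he (k, false) (mk_mem_rung k false))
    rw [len_rung]
    simp only [tailLen] at this ⊢
    linarith

theorem isMetricRepresentation : ladder.IsMetricRepresentation len := by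
  refine isMetricRepresentation_of_compactSpace finite_neighborSet len_pos arcDist_ne_top
    fun ω ε hε => ?_
  -- Twelve parts for reaching an endvertex along the edge, one for going on from there to the end.
  obtain ⟨n, hn⟩ := exists_tailLen_lt (show 0 < ε / 13 by positivity)
  have hn' := tailLen_pos n
  refine ⟨bottom n, containsComponent_bottom (fun v hv => ?_) (fun e t he => ?_) fun ω' => ?_⟩
  · have := tailLen_anti.antitone hv
    exact (ENNReal.toReal_le_of_le_ofReal (tailLen_pos _).le
      (arcDist_vert_atEnd_le v ω)).trans_lt (by linarith)
  · have h1 := len_le he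
    have h2 := tailLen_anti.antitone (he _ ((mem_edge_iff e _).mpr (Or.inl rfl)))
    exact (ENNReal.toReal_le_of_le_ofReal (add_pos (len_pos e) (tailLen_pos _)).le
      (arcDist_inner_atEnd_le e t ω)).trans_lt (by linarith)
  · change (arcDist len (atEnd ω') (atEnd ω)).toReal < ε
    rw [Subsingleton.elim ω' ω, arcDist_self]
    exact hε

end ladder

end SimpleGraph

/-! ### Even edge sets and the cycle space of the ladder -/

theorem Set.odd_ncard_inter_singleton {α : Type*} (J : Set α) (a : α) :
    Odd (J ∩ {a}).ncard ↔ a ∈ J := by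
  by_cases ha : a ∈ J
  · simp [ha]
  · simp [ha]

theorem Set.odd_ncard_inter_pair {α : Type*} (J : Set α) {a b : α} (hab : a ≠ b) :
    Odd (J ∩ {a, b}).ncard ↔ ¬ (a ∈ J ↔ b ∈ J) := by
  by_cases ha : a ∈ J <;> by_cases hb : b ∈ J
  · simp [ha, hb, inter_insert_of_mem, ncard_pair hab]
  · simp [ha, hb, inter_insert_of_mem]
  · simp [ha, hb, inter_insert_of_notMem]
  · simp [ha, hb, inter_insert_of_notMem]

theorem Set.even_ncard_inter_triple {α : Type*} (J : Set α) {a b c : α} (hab : a ≠ b)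
    (hac : a ≠ c) (hbc : b ≠ c) :
    Even (J ∩ {a, b, c}).ncard ↔ (a ∈ J ↔ ¬ (b ∈ J ↔ c ∈ J)) := by
  have hf : (J ∩ {b, c}).Finite := (toFinite {b, c}).subset inter_subset_right
  have hn : a ∉ J ∩ {b, c} := fun h => by
    rcases h.2 with h | h
    exacts [hab h, hac h]
  by_cases ha : a ∈ J
  · rw [inter_insert_of_mem ha, ncard_insert_of_notMem hn hf, Nat.even_add_one,
      Nat.not_even_iff_odd, odd_ncard_inter_pair J hbc]
    simp [ha]
  · rw [inter_insert_of_notMem ha, ← Nat.not_odd_iff_even, odd_ncard_inter_pair J hbc]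
    simp [ha]

namespace SimpleGraph

open EndSpace

theorem EndSpace.exists_vert_of_mem_range_edgePath {V : Type*} {G : SimpleGraph V}
    {e e' : G.edgeSet} (hne : e ≠ e') {z : G.EndSpace} (h : z ∈ range (edgePath e))
    (h' : z ∈ range (edgePath e')) : ∃ v, v ∈ e.1 ∧ v ∈ e'.1 ∧ z = vert v := by
  cases z with
  | vert v => exact ⟨v, vert_mem_range_edgePath.mp h, vert_mem_range_edgePath.mp h', rfl⟩
  | inner e₀ t =>
    exact (hne ((inner_mem_range_edgePath.mp h).symm.trans (inner_mem_range_edgePath.mp h'))).elim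
  | atEnd ω => exact (atEnd_notMem_range_edgePath h).elim

theorem EndSpace.eq_of_mem_edgesIn {V : Type*} {G : SimpleGraph V} {e : G.edgeSet}
    {X : Set G.EndSpace} (h : e ∈ edgesIn X) {S : Set G.edgeSet}
    (hX : X ⊆ ⋃ e ∈ S, range (edgePath e)) : e ∈ S := by
  have h1 := hX (inner_mem_of_mem_edgesIn h ⟨1 / 2, by norm_num, by norm_num⟩)
  simp only [mem_iUnion] at h1
  obtain ⟨e', he', h2⟩ := h1
  rwa [inner_mem_range_edgePath.mp h2]

namespace ladder

/-- The edges of the `k`-th square of the ladder. -/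
def square (k : ℕ) : Set ladder.edgeSet := {rail k false, rung (k + 1), rung k, rail k true}

theorem rail_mem_square {k i : ℕ} {b : Bool} : rail k b ∈ square i ↔ i = k := by
  cases b <;> simp [square, rail_inj, rail_ne_rung, eq_comm]

theorem rung_mem_square {k i : ℕ} : rung k ∈ square i ↔ i + 1 = k ∨ i = k := by
  simp [square, rung_inj, rail_ne_rung.symm, eq_comm]

theorem finite_square (k : ℕ) : (square k).Finite := by
  unfold square; exact toFinite _

theorem square_mem_circuits (k : ℕ) : square k ∈ ladder.circuits := by
  -- The square is glued from two arcs from `(k, false)` to `(k + 1, true)`, one crossing by the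
  -- upper rung and one by the lower.
  have a1 := isArc_range_edgePath (rail_val k false)
  have a2 := isArc_range_edgePath (rung_val (k + 1))
  have a3 := isArc_range_edgePath (rung_val k)
  have a4 := isArc_range_edgePath (rail_val k true)
  have a12 := a1.union a2 (by
    rintro z ⟨h, h'⟩
    obtain ⟨v, hv, hv', rfl⟩ := exists_vert_of_mem_range_edgePath rail_ne_rung h h'
    rw [mem_rail] at hv
    rw [mem_rung] at hv'
    rcases hv with rfl | rfl <;> simp_all)
  have a34 := a3.union a4 (by
    rintro z ⟨h, h'⟩
    obtain ⟨v, hv, hv', rfl⟩ := exists_vert_of_mem_range_edgePath rail_ne_rung.symm h h'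
    rw [mem_rung] at hv
    rw [mem_rail] at hv'
    rcases hv with rfl | rfl <;> simp_all)
  have hC := a12.isCircle_union a34 (by simp) (by
    rintro z ⟨h | h, h' | h'⟩
    · obtain ⟨v, hv, hv', rfl⟩ := exists_vert_of_mem_range_edgePath rail_ne_rung h h'
      rw [mem_rail] at hv
      rw [mem_rung] at hv'
      rcases hv with rfl | rfl <;> simp_all
    · obtain ⟨v, hv, hv', rfl⟩ := exists_vert_of_mem_range_edgePath
        (fun h => by simpa using (rail_inj.mp h).2) h h'
      rw [mem_rail] at hv hv'
      rcases hv with rfl | rfl <;> simp_all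
    · obtain ⟨v, hv, hv', rfl⟩ := exists_vert_of_mem_range_edgePath
        (fun h => by simpa using rung_inj.mp h) h h'
      rw [mem_rung] at hv hv'
      rcases hv with rfl | rfl <;> simp_all
    · obtain ⟨v, hv, hv', rfl⟩ := exists_vert_of_mem_range_edgePath rail_ne_rung.symm h h'
      rw [mem_rung] at hv
      rw [mem_rail] at hv'
      rcases hv with rfl | rfl <;> simp_all)
  refine ⟨_, hC, subset_antisymm ?_ fun e he => eq_of_mem_edgesIn he ?_⟩
  · rintro e (rfl | rfl | rfl | rfl) t
    · exact Or.inl (Or.inl ⟨t, rfl⟩)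
    · exact Or.inl (Or.inr ⟨t, rfl⟩)
    · exact Or.inr (Or.inl ⟨t, rfl⟩)
    · exact Or.inr (Or.inr ⟨t, rfl⟩)
  · rintro z ((h | h) | (h | h)) <;> refine mem_biUnion ?_ h <;> simp [square]

/-- `D` has an even number of edges at every vertex. -/
def IsEven (D : Set ladder.edgeSet) : Prop := ∀ v, Even (D ∩ {e | v ∈ e.1}).ncard

theorem incident_zero (b : Bool) :
    {e : ladder.edgeSet | ((0, b) : ℕ × Bool) ∈ e.1} = {rung 0, rail 0 b} := by
  ext e
  rcases eq_rail_or_rung e with ⟨k, a, rfl⟩ | ⟨k, rfl⟩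
  · simp only [mem_ofPred_eq, mem_rail, Prod.mk.injEq, mem_insert_iff, mem_singleton_iff,
      rail_inj, rail_ne_rung, false_or]
    constructor
    · rintro (⟨h, h'⟩ | ⟨h, h'⟩)
      · exact ⟨h.symm, h'.symm⟩
      · omega
    · rintro ⟨rfl, rfl⟩; exact Or.inl ⟨rfl, rfl⟩
  · simp only [mem_ofPred_eq, mem_rung, Prod.mk.injEq, mem_insert_iff, mem_singleton_iff,
      rung_inj, rail_ne_rung.symm, or_false]
    cases b <;> simp [eq_comm]

theorem incident_succ (k : ℕ) (b : Bool) :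
    {e : ladder.edgeSet | ((k + 1, b) : ℕ × Bool) ∈ e.1} =
      {rung (k + 1), rail k b, rail (k + 1) b} := by
  ext e
  rcases eq_rail_or_rung e with ⟨j, a, rfl⟩ | ⟨j, rfl⟩
  · simp only [mem_ofPred_eq, mem_rail, Prod.mk.injEq, mem_insert_iff, mem_singleton_iff,
      rail_inj, rail_ne_rung, false_or]
    constructor
    · rintro (⟨h, h'⟩ | ⟨h, h'⟩)
      · exact Or.inr ⟨h.symm, h'.symm⟩
      · exact Or.inl ⟨by omega, h'.symm⟩
    · rintro (⟨rfl, rfl⟩ | ⟨rfl, rfl⟩)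
      · exact Or.inr ⟨rfl, rfl⟩
      · exact Or.inl ⟨rfl, rfl⟩
  · simp only [mem_ofPred_eq, mem_rung, Prod.mk.injEq, mem_insert_iff, mem_singleton_iff,
      rung_inj, rail_ne_rung.symm, or_false]
    cases b <;> simp [eq_comm]

theorem IsEven.rung_zero_mem_iff {D : Set ladder.edgeSet} (hD : IsEven D) (b : Bool) :
    rung 0 ∈ D ↔ rail 0 b ∈ D := by
  have h := hD (0, b)
  rw [incident_zero, ← Nat.not_odd_iff_even, odd_ncard_inter_pair D rail_ne_rung.symm,
    not_not] at h
  exact h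

theorem IsEven.rung_succ_mem_iff {D : Set ladder.edgeSet} (hD : IsEven D) (k : ℕ) (b : Bool) :
    rung (k + 1) ∈ D ↔ ¬ (rail k b ∈ D ↔ rail (k + 1) b ∈ D) := by
  have h := hD (k + 1, b)
  rwa [incident_succ, even_ncard_inter_triple D rail_ne_rung.symm rail_ne_rung.symm
    (fun h => by simpa using (rail_inj.mp h).1)] at h

/-- At both of its endvertices a rung decides whether membership switches from one rail to the next,
so the two sides switch together. -/
theorem IsEven.rail_mem_iff {D : Set ladder.edgeSet} (hD : IsEven D) (k : ℕ) (b : Bool) :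
    rail k b ∈ D ↔ rail k false ∈ D := by
  induction k with
  | zero => rw [← hD.rung_zero_mem_iff b, ← hD.rung_zero_mem_iff false]
  | succ k ih =>
    have h1 := hD.rung_succ_mem_iff k b
    have h2 := hD.rung_succ_mem_iff k false
    tauto

/-- The rails at level `k` lie in no square but the `k`-th, so `D` dictates which squares to take;
both rails agree on this. The rungs then come out right by evenness, as rung `k + 1` lies in
precisely the squares `k` and `k + 1`. -/
theorem IsEven.mem_thinSums {D : Set ladder.edgeSet} (hD : IsEven D) :
    D ∈ thinSums {D | D ∈ ladder.circuits ∧ D.Finite} := by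
  set J : Set ℕ := {k | rail k false ∈ D} with hJ
  have himg : ∀ e, Subtype.val '' {i : J | e ∈ square i} = J ∩ {k | e ∈ square k} := by
    intro e
    ext k
    constructor
    · rintro ⟨i, hi, rfl⟩; exact ⟨i.2, hi⟩
    · rintro ⟨hk, hk'⟩; exact ⟨⟨k, hk⟩, hk', rfl⟩
  have hrail : ∀ k b, {i | rail k b ∈ square i} = {k} := fun k b => by
    ext i; simp [rail_mem_square]
  have hrung0 : {i | rung 0 ∈ square i} = {0} := by
    ext i; simp [rung_mem_square]
  have hrung : ∀ k, {i | rung (k + 1) ∈ square i} = {k, k + 1} := fun k => by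
    ext i; simp [rung_mem_square]
  refine ⟨J, fun i => square i, fun i => ⟨square_mem_circuits i, finite_square i⟩,
    fun e => ?_, ?_⟩
  · refine Finite.of_finite_image (f := Subtype.val) ?_ Subtype.val_injective.injOn
    rw [himg]
    refine Finite.subset ?_ inter_subset_right
    rcases eq_rail_or_rung e with ⟨k, b, rfl⟩ | ⟨k, rfl⟩
    · rw [hrail]; exact toFinite _
    · rcases k with _ | k
      · rw [hrung0]; exact toFinite _
      · rw [hrung]; exact toFinite _
  · ext e
    rw [mem_ofPred_eq, ← ncard_image_of_injective _ Subtype.val_injective, himg]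
    rcases eq_rail_or_rung e with ⟨k, b, rfl⟩ | ⟨k, rfl⟩
    · rw [hrail, odd_ncard_inter_singleton]
      exact hD.rail_mem_iff k b
    · rcases k with _ | k
      · rw [hrung0, odd_ncard_inter_singleton]
        exact hD.rung_zero_mem_iff false
      · rw [hrung, odd_ncard_inter_pair _ (by omega)]
        exact hD.rung_succ_mem_iff k false

theorem isEven_of_mem_topCycleSpace {D : Set ladder.edgeSet} (hD : D ∈ ladder.topCycleSpace) :
    IsEven D := by
  intro v
  refine even_ncard_inter_of_mem_thinSums (finite_setOf_mem_edge (finite_neighborSet v)) ?_ hD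
  rintro _ ⟨C, hC, rfl⟩
  exact hC.even_ncard_edgesIn (finite_neighborSet v)

theorem generatesTopCycleSpace_finite_circuits :
    ladder.GeneratesTopCycleSpace {D | D ∈ ladder.circuits ∧ D.Finite} := by
  apply subset_antisymm
  · rintro D ⟨ι, F, hF, hfin, rfl⟩
    exact ⟨ι, F, fun i => (hF i).1, hfin, rfl⟩
  · exact fun D hD => (isEven_of_mem_topCycleSpace hD).mem_thinSums

/-! ### No finite circle is geodetic -/

/-- Without rungs, evenness continues a rail of `D` upwards along its side forever. -/
theorem IsEven.exists_rung_mem {D : Set ladder.edgeSet} (hD : IsEven D) (hfin : D.Finite)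
    (hne : D.Nonempty) : ∃ i, rung i ∈ D := by
  by_contra hno
  push Not at hno
  obtain ⟨e, he⟩ := hne
  rcases eq_rail_or_rung e with ⟨k, b, rfl⟩ | ⟨k, rfl⟩
  · have hall : ∀ j, rail (k + j) b ∈ D := by
      intro j
      induction j with
      | zero => exact he
      | succ j ih =>
        have := (not_congr (hD.rung_succ_mem_iff (k + j) b)).mp (hno _)
        exact (not_not.mp this).mp ih
    refine infinite_of_injective_forall_mem (f := fun j => rail (k + j) b) (fun i j hij => ?_)
      hall hfin
    have := (rail_inj.mp hij).1
    omega
  · exact hno k he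

theorem arcDist_rung_le (i : ℕ) :
    arcDist len (vert (i, false)) (vert (i, true)) ≤ ENNReal.ofReal (2 * tailLen i) := by
  obtain ⟨ω, hω⟩ := end_nonempty
  rw [two_mul, ENNReal.ofReal_add (tailLen_pos i).le (tailLen_pos i).le]
  refine (arcDist_triangle _ (atEnd ⟨ω, hω⟩) _).trans
    (add_le_add (arcDist_vert_atEnd_le _ _) ?_)
  rw [arcDist_comm]
  exact arcDist_vert_atEnd_le _ _

/-- Any arc in a circle with finitely many edges that joins the endvertices of a rung is longer
than the detour through the end. -/
theorem lt_length_of_finite {C A : Set ladder.EndSpace} (hC : IsCircle C)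
    (hfin : (edgesIn C).Finite) (hAC : A ⊆ C) {i : ℕ} (hi : rung i ∈ edgesIn C)
    (hA : IsArc (vert (i, false)) (vert (i, true)) A) :
    ENNReal.ofReal (2 * tailLen i) < EndSpace.length len A := by
  obtain ⟨N, hN⟩ : ∃ N, ∀ e ∈ edgesIn C, ∀ v ∈ e.1, v.1 ≤ N := by
    obtain ⟨N, hN⟩ := (hfin.image fun e => (Quot.out e.1).1.1 + (Quot.out e.1).2.1).bddAbove
    refine ⟨N, fun e he v hv => ?_⟩
    have h1 : (Quot.out e.1).1.1 + (Quot.out e.1).2.1 ≤ N := hN ⟨e, he, rfl⟩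
    rcases (mem_edge_iff e v).mp hv with rfl | rfl <;> omega
  -- Cutting off above height `N` makes the function continuous at the end. The rails on which the
  -- cut makes it too steep do not belong to `C`. The shift by `tailLen N` is the excess of the arc
  -- over the detour.
  set h : ℕ × Bool → ℝ := fun v =>
    if v.1 ≤ N then (if v.2 then -1 else 1) * (tailLen v.1 + tailLen N) else 0 with hh
  have hN0 := tailLen_pos N
  have hi0 := tailLen_pos i
  have hcont : Continuous (linExt (G := ladder) h 0) := by
    refine continuous_linExt fun ε hε => (finite_fst_lt (N + 1)).subset fun v hv => ?_
    by_contra hvN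
    have hvN' : ¬ v.1 ≤ N := fun h' => hvN (Nat.lt_succ_of_le h')
    have h1 : ε ≤ |h v - 0| := hv
    simp only [hh, hvN', if_false, sub_zero, abs_zero] at h1
    linarith
  have hval : ∀ k ≤ N, ∀ b, h (k, b) = (if b then -1 else 1) * (tailLen k + tailLen N) :=
    fun k hk b => if_pos hk
  have hslope : ∀ e ∈ edgesIn C, |h (Quot.out e.1).1 - h (Quot.out e.1).2| ≤ len e := by
    intro e he
    have hsym : ∀ {v w}, e.1 = s(v, w) →
        |h (Quot.out e.1).1 - h (Quot.out e.1).2| = |h v - h w| := by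
      intro v w hvw
      rcases out_eq_or_out_eq_swap hvw with ⟨h1, h2⟩ | ⟨h1, h2⟩ <;> rw [h1, h2]
      exact abs_sub_comm _ _
    rcases eq_rail_or_rung e with ⟨k, b, rfl⟩ | ⟨k, rfl⟩
    · have hk := hN _ he (k + 1, b) (mem_rail.mpr (Or.inr rfl))
      have hk0 := tailLen_pos k
      rw [hsym (rail_val k b), hval k (by omega), hval (k + 1) hk, len_rail, tailLen_succ,
        ← mul_sub, abs_mul]
      have h1 : |(if b then -1 else 1 : ℝ)| = 1 := by split_ifs <;> simp
      have h2 : tailLen k + tailLen N - (tailLen k / 4 + tailLen N) = (1 / 4) ^ k / 4 := by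
        unfold tailLen; ring
      rw [h1, h2, one_mul, abs_of_pos (by positivity)]
    · have hk := hN _ he (k, true) (mk_mem_rung k true)
      have hk0 := tailLen_pos k
      -- Since `k ≤ N`, the variation 2 * (`tailLen k` + `tailLen N`) along the rung is at most 4 *
      -- `tailLen k`, well below its length 12 * `tailLen k`.
      have h1 := tailLen_anti.antitone hk
      rw [hsym (rung_val k), hval k hk, hval k hk, len_rung]
      have h2 : (4 : ℝ) * (1 / 4) ^ k = 12 * tailLen k := by unfold tailLen; ring
      simp only [Bool.false_eq_true, if_false, if_true]
      rw [h2, abs_le]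
      simp only at h1
      constructor <;> linarith
  -- The slope bound is needed only on edges that the arc meets in inner points, and these belong to
  -- the circle.
  have hmain := hA.ofReal_abs_sub_le hcont zero_le_one len_pos (by
    rintro e ⟨t, ht⟩ s t'
    rw [abs_linExt_edgePath_sub, one_mul]
    exact mul_le_mul_of_nonneg_right (hslope e (hC.mem_edgesIn (hAC ht))) (abs_nonneg _))
  rw [ENNReal.ofReal_one, one_mul] at hmain
  refine lt_of_lt_of_le ?_ hmain
  have hiN := hN _ hi (i, true) (mk_mem_rung i true)
  have hdiff : linExt (G := ladder) h 0 (vert (i, false)) -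
      linExt (G := ladder) h 0 (vert (i, true)) =
      2 * tailLen i + 2 * tailLen N := by
    simp only [linExt]
    rw [hval i hiN, hval i hiN]
    simp only [Bool.false_eq_true, if_false, if_true]
    ring
  rw [hdiff, abs_of_pos (by positivity)]
  exact (ENNReal.ofReal_lt_ofReal_iff (by positivity)).mpr (by linarith)

theorem not_finite_edgesIn_of_isGeodeticCircle {C : Set ladder.EndSpace}
    (hC : IsGeodeticCircle len C) : ¬ (edgesIn C).Finite := by
  intro hfin
  have heven : IsEven (edgesIn C) := fun v => hC.1.even_ncard_edgesIn (finite_neighborSet v)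
  obtain ⟨i, hi⟩ := heven.exists_rung_mem hfin hC.1.edgesIn_nonempty
  obtain ⟨A, hAC, hA, hlen⟩ := hC.2 _ (vert_mem_of_mem_edgesIn hi (mk_mem_rung i false)) _
    (vert_mem_of_mem_edgesIn hi (mk_mem_rung i true))
  have h1 := lt_length_of_finite hC.1 hfin hAC hi hA
  rw [hlen] at h1
  exact absurd (arcDist_rung_le i) (not_le.mpr h1)

/-- There is no finite geodetic circuit at all, so the only thin sum available is the empty set,
whereas `square 0` is a nonempty element of the cycle space. -/
theorem not_generatesTopCycleSpace_finite_geodetic :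
    ¬ ladder.GeneratesTopCycleSpace {D | D ∈ ladder.geodeticCircuits len ∧ D.Finite} := by
  intro hgen
  have hsq : square 0 ∈ ladder.topCycleSpace :=
    ⟨Unit, fun _ => square 0, fun _ => square_mem_circuits 0, fun _ => toFinite _, by
      ext e
      by_cases he : e ∈ square 0 <;> simp [he]⟩
  rw [← hgen] at hsq
  obtain ⟨ι, F, hF, -, h⟩ := hsq
  have h0 : rail 0 false ∈ square 0 := rail_mem_square.mpr rfl
  rw [h] at h0
  obtain ⟨i, -⟩ := nonempty_of_ncard_ne_zero (Odd.pos h0).ne'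
  obtain ⟨⟨C, hC, hCD⟩, hfin⟩ := hF i
  exact not_finite_edgesIn_of_isGeodeticCircle hC (hCD ▸ hfin)

end ladder

end SimpleGraph

end

theorem mainTheorem5 :
    ∃ (V : Type) (G : SimpleGraph V) (ℓ : G.edgeSet → ℝ),
      (∀ v, (G.neighborSet v).Finite) ∧ G.Connected ∧ G.IsOneEnded ∧
      G.IsMetricRepresentation ℓ ∧
      (∀ C : Set G.EndSpace, SimpleGraph.EndSpace.IsGeodeticCircle ℓ C →
        ¬ (SimpleGraph.EndSpace.edgesIn C).Finite) ∧
      ¬ G.GeneratesTopCycleSpace {D | D ∈ G.geodeticCircuits ℓ ∧ D.Finite} ∧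
      G.GeneratesTopCycleSpace {D | D ∈ G.circuits ∧ D.Finite} :=
  ⟨ℕ × Bool, SimpleGraph.ladder, SimpleGraph.ladder.len, SimpleGraph.ladder.finite_neighborSet,
    SimpleGraph.ladder.connected, SimpleGraph.ladder.isOneEnded,
    SimpleGraph.ladder.isMetricRepresentation,
    fun _ => SimpleGraph.ladder.not_finite_edgesIn_of_isGeodeticCircle,
    SimpleGraph.ladder.not_generatesTopCycleSpace_finite_geodetic,
    SimpleGraph.ladder.generatesTopCycleSpace_finite_circuits⟩
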